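/- **Theorem 1.1.** Let $n\ge 1$ and let $\mathbb H^n=\mathbb R^{2n}\times\mathbb R$ be the Heisenberg group with product $$(x,t)\cdot(x',t')=\Big(x+x',\;t+t'+\tfrac12\sum_{j=1}^n(x_jx'_{j+n}-x_{j+n}x'_j)\Big),\qquad \|(x,t)\|_\infty=\max\{|x|,|t|^{1/2}\}.$$ Identify $\mathbb W=\{x_1=0\}\subset\mathbb H^n$ with $\mathbb R^{2n}=\mathbb R^{2n-1}\times\mathbb R$ by writing its points as $A=(x_2,\dots,x_{2n},t)$, with $x_1=0$ understood. Let $\omega\subset\mathbb W$ be open and $\phi:\omega\to\mathbb R$ continuous. Put $\Phi(A)=A\cdot(\phi(A)e_1)$ and $$d_\phi(A,B)=\|\pi_{\mathbb O_1}(\Phi(A)^{-1}\cdot\Phi(B))\|_\infty+\|\pi_{\mathbb T}(\Phi(A)^{-1}\cdot\Phi(B))\|_\infty ,$$ where $\pi_{\mathbb O_1}(x,t)=((0,x_2,\dots,x_{2n}),0)$ and $\pi_{\mathbb T}(x,t)=(0,t)$. The function $\phi$ is *locally intrinsic Lipschitz* in $\omega$ if for every $\omega'\Subset\omega$ there is $L>0$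 with $|\phi(A)-\phi(B)|\le L\,d_\phi(A,B)$ for all $A,B\in\omega'$. On $\mathbb W$ let $$X_j=\partial_{x_j}-\tfrac{x_{j+n}}2\partial_t\ (2\le j\le n),\qquad X_{n+1}=\partial_{x_{n+1}},\qquad X_{j+n}=\partial_{x_{j+n}}+\tfrac{x_j}2\partial_t\ (2\le j\le n).$$ For $w=(w_2,\dots,w_{2n})\in L^\infty_{loc}(\omega;\mathbb R^{2n-1})$, the function $\phi$ is a *distributional solution* of $\nabla^\phi\phi=w$ in $\omega$ if for every $\psi\in C^\infty_c(\omega)$ $$\int_\omega\phi\,X_i\psi\,d\mathcal L^{2n}=-\int_\omega w_i\,\psi\,d\mathcal L^{2n}\qquad(2\le i\le 2n,\ i\ne n+1),$$ $$\int_\omega\Big(\phi\,\partial_{x_{n+1}}\psi+\tfrac12\phi^2\,\partial_t\psi\Big)\,d\mathcal L^{2n}=-\int_\omega w_{n+1}\,\psi\,d\mathcal L^{2n}.$$ (For $n=1$, writing $z=x_2$, only the last equation is present: it is the balance law $\phi_z+[\phi^2/2]_t=w$.) Then $\phi$ is locally intrinsic Lipschitz in $\omega$ if and only if there is $w\in L^\infty_{loc}(\omega;\mathbb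 R^{2n-1})$ such that $\phi$ is a distributional solution of $\nabla^\phi\phi=w$ in $\omega$. -/

import Mathlib

open MeasureTheory

noncomputable section

namespace HeisenbergGraph

/-- The Heisenberg group `ℍⁿ ≡ ℝ²ⁿ × ℝ`, with points `P = (x, t)`.  The `2n` horizontal coordinates
are indexed by `Fin n ⊕ Fin n`: with `j : Fin n` counted from `0`, the entry `x (Sum.inl j)` is
`x_{j+1}` and `x (Sum.inr j)` is `x_{j+1+n}`. -/
@[ext]
structure Heis (n : ℕ) where
  x : Fin n ⊕ Fin n → ℝ
  t : ℝ

namespace Heis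

variable {n : ℕ}

instance : Mul (Heis n) where
  mul P Q := ⟨P.x + Q.x, P.t + Q.t +
    (1 / 2) * ∑ j : Fin n, (P.x (Sum.inl j) * Q.x (Sum.inr j) - P.x (Sum.inr j) * Q.x (Sum.inl j))⟩

instance : One (Heis n) where
  one := ⟨0, 0⟩

instance : Inv (Heis n) where
  inv P := ⟨-P.x, -P.t⟩

@[simp] theorem mul_x (P Q : Heis n) : (P * Q).x = P.x + Q.x := rfl

@[simp] theorem mul_t (P Q : Heis n) : (P * Q).t = P.t + Q.t +
    (1 / 2) * ∑ j : Fin n,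
      (P.x (Sum.inl j) * Q.x (Sum.inr j) - P.x (Sum.inr j) * Q.x (Sum.inl j)) := rfl

@[simp] theorem one_x : (1 : Heis n).x = 0 := rfl

@[simp] theorem one_t : (1 : Heis n).t = 0 := rfl

@[simp] theorem inv_x (P : Heis n) : (P⁻¹).x = -P.x := rfl

@[simp] theorem inv_t (P : Heis n) : (P⁻¹).t = -P.t := rfl

instance : Group (Heis n) :=
  Group.ofLeftAxioms
    (by
      intro P Q R
      ext i
      · simp [add_assoc]
      · simp only [mul_t, mul_x, Pi.add_apply]
        have h : ∀ a b c d e f : ℝ, a + c = d + b → a + c + e = d + b + e := by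
          intro a b c d e f h; rw [h]
        simp only [add_mul, mul_add, Finset.sum_add_distrib, Finset.sum_sub_distrib]
        ring)
    (by intro P; ext i <;> simp)
    (by
      intro P
      ext i
      · simp
      · simp [mul_comm])

/-- The homogeneous norm `‖(x, t)‖_∞ = max {|x|, |t|^{1/2}}`, with `|x|` the Euclidean norm. -/
def homNorm (P : Heis n) : ℝ :=
  max (Real.sqrt (∑ i, P.x i ^ 2)) (Real.sqrt |P.t|)

/-- The projection onto `𝕋 = {x = 0}`. -/
def projT (P : Heis n) : Heis n := ⟨0, P.t⟩

variable [NeZero n]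

/-- The point `s e₁`. -/
def smulE1 (s : ℝ) : Heis n := ⟨Pi.single (Sum.inl 0) s, 0⟩

/-- The projection onto `𝕆₁ = {x₁ = 0, t = 0}`. -/
def projO1 (P : Heis n) : Heis n := ⟨Function.update P.x (Sum.inl 0) 0, 0⟩

end Heis

/-- The indices of the `2n - 1` coordinates other than `x₁`. -/
abbrev WIdx (n : ℕ) [NeZero n] : Type := {i : Fin n ⊕ Fin n // i ≠ Sum.inl 0}

/-- The subgroup `𝕎 = {x₁ = 0}` of `ℍⁿ`, identified with `ℝ²ⁿ = ℝ²ⁿ⁻¹ × ℝ`; its points are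
`A = (z, t)`, where `z` collects the coordinates `x₂, …, x_{2n}`. -/
abbrev W (n : ℕ) [NeZero n] : Type := (WIdx n → ℝ) × ℝ

variable {n : ℕ} [NeZero n]

/-- The index of the coordinate `x_{n+1}` (that is, `z_n`), conjugate to `x₁`. -/
def yIdx (n : ℕ) [NeZero n] : WIdx n := ⟨Sum.inr 0, by simp⟩

/-- The inclusion `𝕎 ⊂ ℍⁿ`. -/
def toHeis (A : W n) : Heis n :=
  ⟨fun i => if h : i ≠ Sum.inl 0 then A.1 ⟨i, h⟩ else 0, A.2⟩

/-- The graph map `Φ(A) = A · φ(A) e₁`. -/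
def graphMap (φ : W n → ℝ) (A : W n) : Heis n := toHeis A * Heis.smulE1 (φ A)

/-- The graph quasidistance
`d_φ(A, B) = ‖π_{𝕆₁}(Φ(A)⁻¹ · Φ(B))‖_∞ + ‖π_𝕋(Φ(A)⁻¹ · Φ(B))‖_∞`. -/
def graphDist (φ : W n → ℝ) (A B : W n) : ℝ :=
  (Heis.projO1 ((graphMap φ A)⁻¹ * graphMap φ B)).homNorm +
    (Heis.projT ((graphMap φ A)⁻¹ * graphMap φ B)).homNorm

/-- `φ` is intrinsic Lipschitz on `S`. -/
def IntrinsicLipschitzOn (φ : W n → ℝ) (S : Set (W n)) : Prop :=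
  ∃ L : ℝ, 0 < L ∧ ∀ A ∈ S, ∀ B ∈ S, |φ A - φ B| ≤ L * graphDist φ A B

/-- `φ` is locally intrinsic Lipschitz on `ω`: it is intrinsic Lipschitz on each set `ω' ⋐ ω`. -/
def LocallyIntrinsicLipschitzOn (φ : W n → ℝ) (ω : Set (W n)) : Prop :=
  ∀ ω' : Set (W n), IsCompact (closure ω') → closure ω' ⊆ ω → IntrinsicLipschitzOn φ ω'

/-- The vector fields `X₂, …, X_{2n}` restricted to `𝕎`, as fields on `ℝ²ⁿ`:
`X_j = ∂_{x_j} - (x_{j+n} / 2) ∂_t` and `X_{j+n} = ∂_{x_{j+n}} + (x_j / 2) ∂_t`.  As `x₁ = 0` on `𝕎`,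
`X_{n+1}` is just `∂_{x_{n+1}}`. -/
def X (i : WIdx n) (A : W n) : W n :=
  (Pi.single i 1,
    match i.1 with
    | Sum.inl j => -((toHeis A).x (Sum.inr j) / 2)
    | Sum.inr j => (toHeis A).x (Sum.inl j) / 2)

/-- The vector field `∂_t` on `𝕎`. -/
def T : W n := (0, 1)

/-- `w ∈ L^∞_loc(ω; ℝ²ⁿ⁻¹)`. -/
def LocallyEssBounded (w : W n → (WIdx n → ℝ)) (ω : Set (W n)) : Prop :=
  ∀ K : Set (W n), IsCompact K → K ⊆ ω → MemLp w ⊤ (volume.restrict K)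

/-- `ψ ∈ C^∞_c(ω)`. -/
def IsTestFunction (ψ : W n → ℝ) (ω : Set (W n)) : Prop :=
  ContDiff ℝ (⊤ : ℕ∞) ψ ∧ HasCompactSupport ψ ∧ tsupport ψ ⊆ ω

/-- `φ` is a distributional solution of the system `∇^φ φ = w` in `ω`, that is of
`X_i φ = w_i` for `i ≠ n + 1` and of
`W^φ φ = X_{n+1} φ + ∂_t (φ² / 2) = w_{n+1}`. -/
def IsDistributionalSolution (φ : W n → ℝ) (w : W n → (WIdx n → ℝ)) (ω : Set (W n)) : Prop :=
  ∀ ψ : W n → ℝ, IsTestFunction ψ ω →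
    (∀ i : WIdx n, i ≠ yIdx n →
      ∫ A in ω, φ A * fderiv ℝ ψ A (X i A) = -∫ A in ω, w A i * ψ A) ∧
    ∫ A in ω, (φ A * fderiv ℝ ψ A (X (yIdx n) A) + (1 / 2) * φ A ^ 2 * fderiv ℝ ψ A T) =
      -∫ A in ω, w A (yIdx n) * ψ A

/-- The explicit form of the graph quasidistance.  The term `j = 0` of the last sum vanishes. -/
theorem graphDist_eq (φ : W n → ℝ) (A B : W n) :
    graphDist φ A B = Real.sqrt (∑ i, (B.1 i - A.1 i) ^ 2) +
      Real.sqrt |B.2 - A.2 - (1 / 2) * (φ A + φ B) * (B.1 (yIdx n) - A.1 (yIdx n)) +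
        (1 / 2) * ∑ j : Fin n, ((toHeis A).x (Sum.inr j) * (toHeis B).x (Sum.inl j) -
          (toHeis A).x (Sum.inl j) * (toHeis B).x (Sum.inr j))| := by
  have hy : ∀ C : W n, (toHeis C).x (Sum.inr 0) = C.1 (yIdx n) := fun C => by simp [toHeis, yIdx]
  have hx : ∀ (C : W n) (i : WIdx n), (toHeis C).x i.1 = C.1 i := fun C i => by
    simp [toHeis, i.2]
  have hΦl : ∀ (C : W n) (j : Fin n), (graphMap φ C).x (Sum.inl j) =
      (toHeis C).x (Sum.inl j) + if j = 0 then φ C else 0 := fun C j => by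
    simp [graphMap, Heis.smulE1, Pi.single_apply]
  have hΦr : ∀ (C : W n) (j : Fin n), (graphMap φ C).x (Sum.inr j) =
      (toHeis C).x (Sum.inr j) := fun C j => by
    simp [graphMap, Heis.smulE1]
  have hΦt : ∀ C : W n, (graphMap φ C).t = C.2 - (1 / 2) * (C.1 (yIdx n) * φ C) := fun C => by
    simp only [graphMap, Heis.mul_t, Heis.smulE1]
    simp [Pi.single_apply, hy]
    simp [toHeis]
    ring
  have hΦx : ∀ (C : W n) (i : WIdx n), (graphMap φ C).x i.1 = C.1 i := fun C i => by
    rw [← hx C i]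
    simp [graphMap, Heis.smulE1, i.2]
  have key : ∀ f : Fin n ⊕ Fin n → ℝ,
      ∑ i, (Function.update f (Sum.inl 0) 0 i) ^ 2 = ∑ i : WIdx n, f i.1 ^ 2 := fun f => by
    rw [← Finset.sum_subtype (Finset.univ.filter fun i : Fin n ⊕ Fin n => i ≠ Sum.inl 0)
      (by simp) (fun i => f i ^ 2), Finset.sum_filter]
    refine Finset.sum_congr rfl fun i _ => ?_
    by_cases h : i = Sum.inl 0
    · simp [h]
    · simp [h]
  unfold graphDist Heis.homNorm
  congr 1
  · rw [max_eq_left]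
    · congr 1
      rw [Heis.projO1]
      simp only [key, Heis.mul_x, Heis.inv_x, Pi.add_apply, Pi.neg_apply, hΦx]
      exact Finset.sum_congr rfl fun i _ => by ring
    · simp [Heis.projO1]
  · rw [max_eq_right]
    · congr 2
      simp only [Heis.projT, Heis.mul_t, Heis.inv_t, Heis.inv_x, Pi.neg_apply, hΦt, hΦl, hΦr]
      have hsum : ∑ j : Fin n,
          (-((toHeis A).x (Sum.inl j) + if j = 0 then φ A else 0) * (toHeis B).x (Sum.inr j) -
            -(toHeis A).x (Sum.inr j) *
              ((toHeis B).x (Sum.inl j) + if j = 0 then φ B else 0)) =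
          ∑ j : Fin n, ((toHeis A).x (Sum.inr j) * (toHeis B).x (Sum.inl j) -
            (toHeis A).x (Sum.inl j) * (toHeis B).x (Sum.inr j)) +
          (A.1 (yIdx n) * φ B - φ A * B.1 (yIdx n)) := by
        have h1 : A.1 (yIdx n) * φ B - φ A * B.1 (yIdx n) =
            ∑ j : Fin n, if j = 0 then ((toHeis A).x (Sum.inr j) * φ B -
              φ A * (toHeis B).x (Sum.inr j)) else 0 := by
          simp [hy]
        rw [h1, ← Finset.sum_add_distrib]
        refine Finset.sum_congr rfl fun j _ => ?_
        split_ifs <;> ring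
      rw [hsum]
      ring
    · simp [Heis.projT]

/-- For `n = 1` the system is the balance law `φ_z + [φ² / 2]_t = w`. -/
theorem isDistributionalSolution_one (φ : W 1 → ℝ) (w : W 1 → (WIdx 1 → ℝ)) (ω : Set (W 1)) :
    IsDistributionalSolution φ w ω ↔ ∀ ψ : W 1 → ℝ, IsTestFunction ψ ω →
      ∫ A in ω, (φ A * fderiv ℝ ψ A (Pi.single (yIdx 1) 1, 0) +
        (φ A ^ 2 / 2) * fderiv ℝ ψ A (0, 1)) = -∫ A in ω, w A (yIdx 1) * ψ A := by
  have hi : ∀ i : WIdx 1, i = yIdx 1 := by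
    rintro ⟨i | i, h⟩
    · exact absurd (congrArg Sum.inl (Subsingleton.elim i 0)) h
    · exact Subtype.ext (congrArg Sum.inr (Subsingleton.elim i 0))
  have hX : ∀ A : W 1, X (yIdx 1) A = (Pi.single (yIdx 1) 1, 0) := fun A => by
    simp [X, yIdx, toHeis]
  constructor
  · intro h ψ hψ
    rw [← (h ψ hψ).2]
    congr 1
    funext A
    rw [hX, T]
    ring
  · intro h ψ hψ
    refine ⟨fun i hne => absurd (hi i) hne, ?_⟩
    rw [← h ψ hψ]
    congr 1
    funext A
    rw [hX, T]
    ring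

end HeisenbergGraph

end

open MeasureTheory

noncomputable section

namespace HeisenbergGraph

open Filter Topology Metric Set
open scoped NNReal

variable {n : ℕ} [NeZero n]

/-! Both sides are equivalent to `WeaklyBounded`: on each compact set the distributions `weakGrad φ
i` are dominated by a multiple of the `L¹` norm of the test function. By duality such functionals
are exactly those with locally bounded densities (`weaklyBounded_iff`), so only inequalities remain
to be proved.

From intrinsic Lipschitz to weakly bounded. For `i ≠ n + 1` the quasidistance along an integral
curve of `Xᵢ` is elapsed time; since the flow preserves volume, difference quotients of `φ` bound
the weak derivative (`abs_integral_X_le`). The nonlinear component is linearized by a kinetic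
formulation: it is the derivative at `s = 0` of `∫∫ kinetic q (φ A) ψ(A + s (∂_{x_{n+1}} + q ∂_t))
dq dA`. After a translation for each `q`, the integrand changes only for levels `q` between two
values of `φ` joined by a line of slope `q`, and the Lipschitz condition puts these levels in an
interval of length `O(|s|)` around `φ A` (`abs_weakGrad_yIdx_le`).

Conversely, a mollification shows that `φ` is Lipschitz along the flows of the linear fields
(`abs_sub_flow_le`). In the `(x_{n+1}, t)` planes Dafermos' argument is applied to mollifications of
`φ` and `φ² / 2`: the balance law is integrated over a thin strip beside a characteristic, and the
net flux is a square up to small errors, hence has a sign; strips on the two sides give the two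
bounds (`abs_sub_along_char_le`). Thus `φ` has curves that are characteristics up to any error `κ`,
along which it is Lipschitz up to `κ`, with constants independent of `κ` (`exists_approxChar`). Two
such curves issued from a vertical pair with very different values would meet while their values
still differ, so `φ` is 1/2-Hölder in `t` (`abs_sub_vertical_le_of_pos`). A flow step, a
characteristic and a vertical comparison then join two nearby points, and compactness passes from
neighbourhoods to relatively compact sets (`locallyIntrinsicLipschitzOn_of_nhds`). -/

instance : (volume : Measure (W n)).IsAddHaarMeasure :=
  inferInstanceAs ((volume : Measure (WIdx n → ℝ)).prod (volume : Measure ℝ)).IsAddHaarMeasure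

instance : (volume : Measure (W n)).IsNegInvariant :=
  Measure.IsAddHaarMeasure.isNegInvariant_of_regular volume

/-! ### Densities of functionals bounded in the `L¹` norm -/

/-- The test functions with support in `U`, as a linear space. -/
def testFunctions (U : Set (W n)) : Submodule ℝ (W n → ℝ) where
  carrier := {ψ | IsTestFunction ψ U}
  add_mem' := fun {a b} ha hb => ⟨ha.1.add hb.1, ha.2.1.add hb.2.1,
    (tsupport_add a b).trans (union_subset ha.2.2 hb.2.2)⟩
  zero_mem' := ⟨contDiff_const, HasCompactSupport.zero, by
    rw [tsupport_eq_empty_iff.2 rfl]; exact empty_subset _⟩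
  smul_mem' := fun c a ha => ⟨contDiff_const.smul ha.1, ha.2.1.smul_left (f := fun _ => c),
    (tsupport_smul_subset_right (fun _ => c) a).trans ha.2.2⟩

theorem IsTestFunction.memLp {ψ : W n → ℝ} {U : Set (W n)} (h : IsTestFunction ψ U)
    (p : ENNReal) (μ : Measure (W n)) [IsFiniteMeasureOnCompacts μ] : MemLp ψ p μ :=
  h.1.continuous.memLp_of_hasCompactSupport h.2.1

/-- A family of bump functions shrinking to the origin. -/
def bump (k : ℕ) : ContDiffBump (0 : W n) where
  rIn := 1 / (k + 1 : ℝ)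
  rOut := 2 / (k + 1 : ℝ)
  rIn_pos := by positivity
  rIn_lt_rOut := by gcongr; norm_num

theorem tendsto_bump_rOut : Tendsto (fun k => (bump (n := n) k).rOut) atTop (𝓝 0) := by
  have := (tendsto_one_div_add_atTop_nhds_zero_nat (𝕜 := ℝ)).const_mul 2
  simpa [bump, div_eq_mul_inv] using! this

/-- The normalized bump function of index `k` centred at `A`. -/
def bumpAt (k : ℕ) (A B : W n) : ℝ := (bump k).normed volume (A - B)

theorem bumpAt_nonneg (k : ℕ) (A B : W n) : 0 ≤ bumpAt k A B := (bump k).nonneg_normed _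

theorem integral_bumpAt (k : ℕ) (A : W n) : ∫ B, bumpAt k A B = 1 := by
  unfold bumpAt
  rw [integral_sub_left_eq_self (fun B => (bump (n := n) k).normed volume B) volume A]
  exact (bump k).integral_normed

theorem bumpAt_eq_zero {k : ℕ} {A B : W n} (h : (bump (n := n) k).rOut ≤ dist B A) :
    bumpAt k A B = 0 := by
  have : A - B ∉ Function.support ((bump (n := n) k).normed volume) := by
    rw [(bump k).support_normed_eq]
    simpa [dist_comm, dist_eq_norm, norm_sub_rev] using h
  exact Function.notMem_support.1 this

theorem tsupport_bumpAt (k : ℕ) (A : W n) :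
    tsupport (bumpAt k A) ⊆ closedBall A (bump (n := n) k).rOut := by
  refine closure_minimal (fun B hB => ?_) isClosed_closedBall
  by_contra h
  exact hB (bumpAt_eq_zero (by simpa using (not_le.1 h).le))

theorem isTestFunction_bumpAt {k : ℕ} {A : W n} {U : Set (W n)}
    (h : closedBall A (bump (n := n) k).rOut ⊆ U) : IsTestFunction (bumpAt k A) U :=
  ⟨((bump k).contDiff_normed).comp (contDiff_const.sub contDiff_id),
    (isCompact_closedBall A _).of_isClosed_subset (isClosed_tsupport _) (tsupport_bumpAt k A),
    (tsupport_bumpAt k A).trans h⟩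

/-- The averages of a locally integrable function against the bumps at `A` converge to its value
at `A`, for almost every `A`. -/
theorem ae_tendsto_integral_mul_bumpAt {f : W n → ℝ} (hf : LocallyIntegrable f volume) :
    ∀ᵐ A : W n, Tendsto (fun k => ∫ B, f B * bumpAt k A B) atTop (𝓝 (f A)) := by
  -- The ratio of outer to inner radius is constantly 2; Lebesgue differentiation needs it bounded.
  have := ContDiffBump.ae_convolution_tendsto_right_of_locallyIntegrable
    (μ := (volume : Measure (W n))) (φ := fun k => bump (n := n) k) (K := 2)
    tendsto_bump_rOut (Eventually.of_forall fun k => le_of_eq (by simp [bump]; ring)) hf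
  filter_upwards [this] with A hA
  refine hA.congr fun k => ?_
  rw [convolution_eq_swap]
  exact integral_congr_ae (Eventually.of_forall fun B => by simp [bumpAt, mul_comm])

/-- The bound makes `F` factor through the image of the test functions in `L²(ν)`; Hahn–Banach
extends it to the whole space and the Riesz theorem represents the extension. Working in `L²` avoids
the duality of `L¹` and `L^∞`; boundedness of the density is recovered in `exists_density`. -/
theorem memLp_two_extend {U : Set (W n)} (F : testFunctions U →ₗ[ℝ] ℝ)
    (ν : Measure (W n)) [IsFiniteMeasureOnCompacts ν] {C : ℝ}
    (hF : ∀ ψ : testFunctions U, |F ψ| ≤ C * (eLpNorm ψ.1 2 ν).toReal) :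
    ∃ w : W n → ℝ, MemLp w 2 ν ∧ ∀ ψ : testFunctions U, F ψ = ∫ A, w A * ψ.1 A ∂ν := by
  let ι : testFunctions U →ₗ[ℝ] Lp ℝ 2 ν :=
    { toFun := fun ψ => (ψ.2.memLp 2 ν).toLp ψ.1
      map_add' := fun _ _ => rfl
      map_smul' := fun _ _ => rfl }
  have hι : ∀ ψ, |F ψ| ≤ C * ‖ι ψ‖ := fun ψ => by
    have h : ‖ι ψ‖ = (eLpNorm ψ.1 2 ν).toReal := Lp.norm_toLp ψ.1 (ψ.2.memLp 2 ν)
    rw [h]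
    exact hF ψ
  have hker : LinearMap.ker ι ≤ LinearMap.ker F := fun ψ h => by
    have h0 : ι ψ = 0 := h
    have := hι ψ
    rw [h0, norm_zero, mul_zero] at this
    exact abs_eq_zero.1 (le_antisymm this (abs_nonneg _))
  let f0 : LinearMap.range ι →ₗ[ℝ] ℝ :=
    ((LinearMap.ker ι).liftQ F hker).comp (ι.quotKerEquivRange.symm : _ →ₗ[ℝ] _)
  have hf0 : ∀ ψ, f0 ⟨ι ψ, LinearMap.mem_range_self ι ψ⟩ = F ψ := fun ψ => by
    have : ι.quotKerEquivRange.symm ⟨ι ψ, LinearMap.mem_range_self ι ψ⟩ =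
        (LinearMap.ker ι).mkQ ψ := by
      rw [LinearEquiv.symm_apply_eq]
      rfl
    simp [f0, this]
  let f1 : StrongDual ℝ (LinearMap.range ι) := f0.mkContinuous C (by
    rintro ⟨_, ψ, rfl⟩
    rw [hf0]
    exact hι ψ)
  obtain ⟨g, hg, -⟩ := exists_extension_norm_eq (LinearMap.range ι) f1
  let w := (InnerProductSpace.toDual ℝ (Lp ℝ 2 ν)).symm g
  refine ⟨w, Lp.memLp w, fun ψ => ?_⟩
  have h1 : inner ℝ w (ι ψ) = F ψ := by
    rw [InnerProductSpace.toDual_symm_apply]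
    exact (hg ⟨ι ψ, LinearMap.mem_range_self ι ψ⟩).trans (hf0 ψ)
  rw [← h1, L2.inner_def]
  refine integral_congr_ae ?_
  filter_upwards [(ψ.2.memLp 2 ν).coeFn_toLp] with A hA
  have h : (ι ψ : W n → ℝ) A = ψ.1 A := hA
  simp [h, mul_comm]

/-- A linear functional on test functions in a set `U` of finite measure which is bounded in the
`L¹` norm is represented by a bounded function. -/
theorem exists_density {U : Set (W n)} (hU : IsOpen U) (hfin : volume U < ⊤)
    (F : testFunctions U →ₗ[ℝ] ℝ) {C : ℝ} (hC : 0 ≤ C)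
    (hF : ∀ ψ : testFunctions U, |F ψ| ≤ C * ∫ A, |ψ.1 A|) :
    ∃ w : W n → ℝ, MemLp w ⊤ volume ∧ ∀ ψ : testFunctions U, F ψ = ∫ A, w A * ψ.1 A := by
  have : IsFiniteMeasure ((volume : Measure (W n)).restrict U) := ⟨by simpa using hfin⟩
  have hsupp : ∀ ψ : testFunctions U, ∀ A ∉ U, ψ.1 A = 0 := fun ψ A hA =>
    image_eq_zero_of_notMem_tsupport fun h => hA (ψ.2.2.2 h)
  -- On a set of finite measure Hölder turns the `L¹` bound into an `L²` bound, at the cost of the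
  -- square root of the measure.
  obtain ⟨v, hv, hvF⟩ := memLp_two_extend F ((volume : Measure (W n)).restrict U)
    (C := C * ((volume.restrict U (univ : Set (W n))).toReal) ^ (1 / 2 : ℝ)) (fun ψ => by
      refine (hF ψ).trans ?_
      rw [mul_assoc]
      refine mul_le_mul_of_nonneg_left ?_ hC
      have h1 : ∫ A, |ψ.1 A| = (eLpNorm ψ.1 1 (volume.restrict U)).toReal := by
        rw [← setIntegral_eq_integral_of_forall_compl_eq_zero (s := U)
          (fun A hA => by rw [hsupp ψ A hA, abs_zero]), eLpNorm_one_eq_lintegral_enorm]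
        rw [← integral_norm_eq_lintegral_enorm (ψ.2.memLp 1 _).1]
        rfl
      have h2 := eLpNorm_le_eLpNorm_mul_rpow_measure_univ (μ := volume.restrict U) (p := 1) (q := 2)
        (f := ψ.1) (by norm_num) (ψ.2.memLp 1 _).1
      rw [h1, mul_comm]
      have h3 := ENNReal.toReal_mono (by
        refine ENNReal.mul_ne_top (ψ.2.memLp 2 _).2.ne ?_
        exact (ENNReal.rpow_lt_top_of_nonneg (by norm_num) (measure_ne_top _ _)).ne) h2
      refine h3.trans (le_of_eq ?_)
      rw [ENNReal.toReal_mul, ← ENNReal.toReal_rpow]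
      norm_num)
  have hw1 : Integrable (U.indicator v) volume :=
    (integrable_indicator_iff hU.measurableSet).2 (hv.integrable (by norm_num))
  have hrep : ∀ ψ : testFunctions U, F ψ = ∫ A, U.indicator v A * ψ.1 A := fun ψ => by
    rw [hvF ψ, ← integral_indicator hU.measurableSet]
    refine integral_congr_ae (Eventually.of_forall fun A => ?_)
    by_cases hA : A ∈ U <;> simp [hA]
  refine ⟨U.indicator v, memLp_top_of_bound hw1.aestronglyMeasurable C ?_, hrep⟩
  filter_upwards [ae_tendsto_integral_mul_bumpAt hw1.locallyIntegrable] with A hA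
  by_cases hAU : A ∈ U
  -- The bumps have `L¹` norm one, so every average of the density is at most `C` in absolute value,
  -- and so is its value at a Lebesgue point.
  · refine le_of_tendsto (hA.norm : Tendsto _ _ (𝓝 ‖U.indicator v A‖)) ?_
    obtain ⟨ε, hε, hball⟩ := Metric.isOpen_iff.1 hU A hAU
    filter_upwards [(tendsto_bump_rOut (n := n)).eventually (gt_mem_nhds hε)] with k hk
    have hψ : IsTestFunction (bumpAt k A) U :=
      isTestFunction_bumpAt ((closedBall_subset_ball hk).trans hball)
    have h2 := hF ⟨_, hψ⟩
    rw [hrep] at h2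
    simp only [abs_of_nonneg (bumpAt_nonneg k A _), integral_bumpAt, mul_one] at h2
    exact h2
  · simpa [hAU] using hC

/-- The sets of an exhaustion of an open set by relatively compact open subsets. -/
def exhaustion (ω : Set (W n)) (m : ℕ) : Set (W n) :=
  ball 0 (m + 1) \ cthickening (1 / (m + 1 : ℝ)) ωᶜ

theorem isOpen_exhaustion (ω : Set (W n)) (m : ℕ) : IsOpen (exhaustion ω m) :=
  isOpen_ball.sdiff isClosed_cthickening

theorem exhaustion_mono (ω : Set (W n)) : Monotone (exhaustion ω) := fun a b h => by
  have h' : (a : ℝ) ≤ b := by exact_mod_cast h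
  refine sdiff_le_sdiff (ball_subset_ball (by linarith)) (cthickening_mono ?_ _)
  exact one_div_le_one_div_of_le (by positivity) (by linarith)

theorem exists_compact_exhaustion (ω : Set (W n)) (m : ℕ) :
    ∃ K, IsCompact K ∧ K ⊆ ω ∧ exhaustion ω m ⊆ K := by
  refine ⟨closedBall 0 (m + 1) \ thickening (1 / (m + 1 : ℝ)) ωᶜ,
    (isCompact_closedBall _ _).diff isOpen_thickening, fun A hA => ?_,
    sdiff_le_sdiff ball_subset_closedBall (thickening_subset_cthickening _ _)⟩
  by_contra h
  exact hA.2 (self_subset_thickening (by positivity) _ h)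

theorem exhaustion_subset (ω : Set (W n)) (m : ℕ) : exhaustion ω m ⊆ ω := by
  obtain ⟨K, -, h, h'⟩ := exists_compact_exhaustion ω m
  exact h'.trans h

theorem exists_subset_exhaustion {ω K : Set (W n)} (hω : IsOpen ω) (hK : IsCompact K)
    (h : K ⊆ ω) : ∃ m, K ⊆ exhaustion ω m := by
  obtain ⟨δ, hδ, hd⟩ := (disjoint_compl_right.mono_left h).exists_cthickenings hK hω.isClosed_compl
  obtain ⟨R, hR⟩ := hK.isBounded.subset_ball 0
  obtain ⟨m, hm⟩ := exists_nat_gt (max R (1 / δ))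
  have h1 : R < m := (le_max_left _ _).trans_lt hm
  have h2 : 1 / δ < m := (le_max_right _ _).trans_lt hm
  refine ⟨m, fun A hA => ⟨ball_subset_ball (by linarith) (hR hA), fun hA' => ?_⟩⟩
  refine disjoint_left.1 hd (self_subset_cthickening K hA) (cthickening_mono ?_ _ hA')
  rw [div_le_iff₀ (by positivity), ← div_le_iff₀' hδ]
  linarith

/-- A linear functional on test functions which is locally bounded in the `L¹` norm is represented
by a locally bounded function. -/
theorem exists_density_of_locally_bounded {ω : Set (W n)} (hω : IsOpen ω)
    (F : testFunctions ω →ₗ[ℝ] ℝ)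
    (hF : ∀ K, IsCompact K → K ⊆ ω → ∃ C, 0 ≤ C ∧ ∀ ψ : testFunctions ω, tsupport ψ.1 ⊆ K →
      |F ψ| ≤ C * ∫ A, |ψ.1 A|) :
    ∃ w : W n → ℝ, (∀ K, IsCompact K → K ⊆ ω → MemLp w ⊤ (volume.restrict K)) ∧
      ∀ ψ : testFunctions ω, F ψ = ∫ A, w A * ψ.1 A := by
  have hinc : ∀ m, testFunctions (exhaustion ω m) ≤ testFunctions ω := fun m ψ hψ =>
    ⟨hψ.1, hψ.2.1, hψ.2.2.trans (exhaustion_subset ω m)⟩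
  have key : ∀ m, ∃ w : W n → ℝ, MemLp w ⊤ volume ∧
      ∀ ψ : testFunctions (exhaustion ω m),
        F (Submodule.inclusion (hinc m) ψ) = ∫ A, w A * ψ.1 A := fun m => by
    obtain ⟨K, hK, hKω, hmK⟩ := exists_compact_exhaustion ω m
    obtain ⟨C, hC, hb⟩ := hF K hK hKω
    exact exists_density (isOpen_exhaustion ω m)
      ((measure_mono hmK).trans_lt hK.measure_lt_top)
      (F.comp (Submodule.inclusion (hinc m))) hC fun ψ => hb _ (ψ.2.2.2.trans hmK)
  choose w hw hrep using key
  have huniq : ∀ k m, k ≤ m → ∀ᵐ A : W n, A ∈ exhaustion ω k → w k A = w m A := by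
    intro k m hkm
    have h1 : LocallyIntegrable (w k - w m) volume :=
      ((hw k).sub (hw m)).locallyIntegrable le_top
    have := (isOpen_exhaustion ω k).ae_eq_zero_of_integral_contDiff_smul_eq_zero
      (h1.locallyIntegrableOn _) (fun g hg hgc hgs => by
        have hgk : IsTestFunction g (exhaustion ω k) := ⟨hg, hgc, hgs⟩
        have hgm : IsTestFunction g (exhaustion ω m) :=
          ⟨hg, hgc, hgs.trans (exhaustion_mono ω hkm)⟩
        have hi : ∀ j, Integrable (fun A => w j A * g A) volume := fun j =>
          ((hw j).locallyIntegrable le_top).integrable_smul_right_of_hasCompactSupport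
            hg.continuous hgc
        have e1 := hrep k ⟨g, hgk⟩
        have e2 := hrep m ⟨g, hgm⟩
        have e3 : ∫ A, w k A * g A = ∫ A, w m A * g A := e1.symm.trans e2
        calc ∫ A, g A • (w k - w m) A = ∫ A, (w k A * g A - w m A * g A) :=
              integral_congr_ae (Eventually.of_forall fun A => by simp; ring)
          _ = 0 := by rw [integral_sub (hi k) (hi m), e3, sub_self])
    filter_upwards [this] with A hA hAk
    exact sub_eq_zero.1 (hA hAk)
  classical
  -- The densities agree almost everywhere on common domains, so the first set of the exhaustion
  -- containing `A` may select the value.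
  let v : W n → ℝ := fun A =>
    if h : ∃ m, A ∈ exhaustion ω m then w (Nat.find h) A else 0
  have hv : ∀ m, ∀ᵐ A : W n, A ∈ exhaustion ω m → v A = w m A := fun m => by
    have := ae_all_iff.2 fun k => ae_all_iff.2 fun h : k ≤ m => huniq k m h
    filter_upwards [this] with A hA hAm
    have h : ∃ m, A ∈ exhaustion ω m := ⟨m, hAm⟩
    simp only [v, dif_pos h]
    exact hA _ (Nat.find_min' h hAm) (Nat.find_spec h)
  refine ⟨v, fun K hK hKω => ?_, fun ψ => ?_⟩
  · obtain ⟨m, hm⟩ := exists_subset_exhaustion hω hK hKω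
    refine ((hw m).restrict K).ae_eq ?_
    rw [Filter.EventuallyEq, ae_restrict_iff' hK.measurableSet]
    filter_upwards [hv m] with A hA hAK
    exact (hA (hm hAK)).symm
  · obtain ⟨m, hm⟩ := exists_subset_exhaustion hω ψ.2.2.1 ψ.2.2.2
    refine (hrep m ⟨ψ.1, ψ.2.1, ψ.2.2.1, hm⟩).trans (integral_congr_ae ?_)
    filter_upwards [hv m] with A hA
    by_cases h : A ∈ exhaustion ω m
    · simp only [hA h]
    · have : ψ.1 A = 0 := image_eq_zero_of_notMem_tsupport fun h' => h (hm h')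
      simp [this]

/-! ### The weak intrinsic gradient and its local bounds -/

theorem continuous_toHeis_x (i : Fin n ⊕ Fin n) : Continuous fun A : W n => (toHeis A).x i := by
  by_cases h : i = Sum.inl 0
  · simp only [toHeis, h]
    simpa using continuous_const
  · simp only [toHeis, ne_eq, h, not_false_eq_true, dif_pos]
    exact (continuous_apply _).comp continuous_fst

theorem continuous_X (i : WIdx n) : Continuous (X i) := by
  rcases i with ⟨i | i, h⟩
  · exact continuous_const.prodMk ((continuous_toHeis_x (Sum.inr i)).div_const 2).neg
  · exact continuous_const.prodMk ((continuous_toHeis_x (Sum.inl i)).div_const 2)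

theorem IsTestFunction.fderiv_eq_zero {ψ : W n → ℝ} {U : Set (W n)} (h : IsTestFunction ψ U)
    {A : W n} (hA : A ∉ U) : fderiv ℝ ψ A = 0 :=
  image_eq_zero_of_notMem_tsupport fun h' => hA (h.2.2 (tsupport_fderiv_subset ℝ h'))

theorem IsTestFunction.eq_zero {ψ : W n → ℝ} {U : Set (W n)} (h : IsTestFunction ψ U)
    {A : W n} (hA : A ∉ U) : ψ A = 0 :=
  image_eq_zero_of_notMem_tsupport fun h' => hA (h.2.2 h')

theorem IsTestFunction.continuous_fderiv {ψ : W n → ℝ} {U : Set (W n)}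
    (h : IsTestFunction ψ U) : Continuous (fderiv ℝ ψ) :=
  h.1.continuous_fderiv (by simp)

theorem integrable_mul_of_tsupport_subset {φ g : W n → ℝ} {ω : Set (W n)} (hω : IsOpen ω)
    (hφ : ContinuousOn φ ω) (hg : Continuous g) (hc : HasCompactSupport g) (hs : tsupport g ⊆ ω) :
    Integrable fun A => φ A * g A := by
  refine Continuous.integrable_of_hasCompactSupport ?_ (hc.mul_left (f := φ))
  refine continuous_of_tsupport fun A hA => ?_
  exact (hφ.continuousAt (hω.mem_nhds (hs (tsupport_mul_subset_right hA)))).mul hg.continuousAt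

theorem IsTestFunction.integrable_mul_fderiv {φ ψ : W n → ℝ} {ω : Set (W n)} (hω : IsOpen ω)
    (hφ : ContinuousOn φ ω) (h : IsTestFunction ψ ω) {V : W n → W n} (hV : Continuous V) :
    Integrable fun A => φ A * fderiv ℝ ψ A (V A) := by
  have hsub : tsupport (fun A => fderiv ℝ ψ A (V A)) ⊆ tsupport ψ :=
    (closure_mono fun A hA => by
      contrapose! hA
      simp [Function.notMem_support.1 hA]).trans (tsupport_fderiv_subset ℝ (f := ψ))
  exact integrable_mul_of_tsupport_subset hω hφ (h.continuous_fderiv.clm_apply hV)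
    (h.2.1.of_isClosed_subset (isClosed_tsupport _) hsub) (hsub.trans h.2.2)

/-- The `i`-th component of `-∇^φ φ`, as a distribution. -/
def weakGrad (φ : W n → ℝ) (i : WIdx n) (ψ : W n → ℝ) : ℝ :=
  ∫ A, (φ A * fderiv ℝ ψ A (X i A) +
    (if i = yIdx n then (1 / 2) * φ A ^ 2 else 0) * fderiv ℝ ψ A T)

/-- The components of `∇^φ φ` are bounded in the norm dual to `L¹`, locally on `ω`. -/
def WeaklyBounded (φ : W n → ℝ) (ω : Set (W n)) : Prop :=
  ∀ K : Set (W n), IsCompact K → K ⊆ ω → ∃ C, 0 ≤ C ∧ ∀ ψ : W n → ℝ, IsTestFunction ψ K →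
    ∀ i, |weakGrad φ i ψ| ≤ C * ∫ A, |ψ A|

theorem continuousOn_flux {φ : W n → ℝ} {ω : Set (W n)} (hφ : ContinuousOn φ ω) (i : WIdx n) :
    ContinuousOn (fun A => if i = yIdx n then (1 / 2) * φ A ^ 2 else 0) ω := by
  split_ifs
  · exact (hφ.pow 2).const_mul _
  · exact continuousOn_const

theorem IsTestFunction.integrable_weakGrad {φ ψ : W n → ℝ} {ω : Set (W n)} (hω : IsOpen ω)
    (hφ : ContinuousOn φ ω) (h : IsTestFunction ψ ω) (i : WIdx n) :
    Integrable fun A => φ A * fderiv ℝ ψ A (X i A) +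
      (if i = yIdx n then (1 / 2) * φ A ^ 2 else 0) * fderiv ℝ ψ A T :=
  (h.integrable_mul_fderiv hω hφ (continuous_X i)).add
    (h.integrable_mul_fderiv hω (continuousOn_flux hφ i) continuous_const)

/-- The functional `weakGrad φ i` is linear on test functions. -/
def weakGradLinear {φ : W n → ℝ} {ω : Set (W n)} (hω : IsOpen ω) (hφ : ContinuousOn φ ω)
    (i : WIdx n) : testFunctions ω →ₗ[ℝ] ℝ where
  toFun ψ := weakGrad φ i ψ.1
  map_add' ψ χ := by
    unfold weakGrad
    rw [← integral_add (ψ.2.integrable_weakGrad hω hφ i) (χ.2.integrable_weakGrad hω hφ i)]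
    refine integral_congr_ae (Eventually.of_forall fun A => ?_)
    have : fderiv ℝ (ψ + χ : testFunctions ω).1 A = fderiv ℝ ψ.1 A + fderiv ℝ χ.1 A :=
      fderiv_add (ψ.2.1.differentiable (by simp) A) (χ.2.1.differentiable (by simp) A)
    simp only [this, add_apply]
    ring
  map_smul' c ψ := by
    unfold weakGrad
    rw [RingHom.id_apply, smul_eq_mul, ← integral_const_mul]
    refine integral_congr_ae (Eventually.of_forall fun A => ?_)
    have : fderiv ℝ (c • ψ : testFunctions ω).1 A = c • fderiv ℝ ψ.1 A :=
      fderiv_const_smul (ψ.2.1.differentiable (by simp) A) c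
    simp only [this, smul_apply, smul_eq_mul]
    ring

theorem isDistributionalSolution_iff {φ : W n → ℝ} {w : W n → (WIdx n → ℝ)} {ω : Set (W n)} :
    IsDistributionalSolution φ w ω ↔ ∀ ψ, IsTestFunction ψ ω → ∀ i,
      weakGrad φ i ψ = -∫ A, w A i * ψ A := by
  have hw : ∀ ψ, IsTestFunction ψ ω → ∀ i, ∫ A in ω, w A i * ψ A = ∫ A, w A i * ψ A :=
    fun ψ hψ i => setIntegral_eq_integral_of_forall_compl_eq_zero fun A hA => by
      rw [hψ.eq_zero hA, mul_zero]
  have h1 : ∀ ψ, IsTestFunction ψ ω → ∀ i, i ≠ yIdx n →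
      ∫ A in ω, φ A * fderiv ℝ ψ A (X i A) = weakGrad φ i ψ := fun ψ hψ i hi => by
    rw [setIntegral_eq_integral_of_forall_compl_eq_zero fun A hA => by
      simp [hψ.fderiv_eq_zero hA]]
    simp [weakGrad, hi]
  have h2 : ∀ ψ, IsTestFunction ψ ω →
      ∫ A in ω, (φ A * fderiv ℝ ψ A (X (yIdx n) A) + (1 / 2) * φ A ^ 2 * fderiv ℝ ψ A T) =
        weakGrad φ (yIdx n) ψ := fun ψ hψ => by
    rw [setIntegral_eq_integral_of_forall_compl_eq_zero fun A hA => by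
      simp [hψ.fderiv_eq_zero hA]]
    simp [weakGrad]
  constructor
  · intro h ψ hψ i
    rw [← hw ψ hψ]
    by_cases hi : i = yIdx n
    · rw [hi, ← h2 ψ hψ]
      exact (h ψ hψ).2
    · rw [← h1 ψ hψ i hi]
      exact (h ψ hψ).1 i hi
  · intro h ψ hψ
    refine ⟨fun i hi => ?_, ?_⟩
    · rw [h1 ψ hψ i hi, hw ψ hψ]
      exact h ψ hψ i
    · rw [h2 ψ hψ, hw ψ hψ]
      exact h ψ hψ _

/-- Existence of `w` is duality applied to each component, with a sign because `weakGrad` is minus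
the gradient. Conversely the essential supremum of `w` on `K` serves as the constant. -/
theorem weaklyBounded_iff {φ : W n → ℝ} {ω : Set (W n)} (hω : IsOpen ω) (hφ : ContinuousOn φ ω) :
    WeaklyBounded φ ω ↔ ∃ w : W n → (WIdx n → ℝ),
      LocallyEssBounded w ω ∧ IsDistributionalSolution φ w ω := by
  constructor
  · intro h
    have key : ∀ i, ∃ w : W n → ℝ, (∀ K, IsCompact K → K ⊆ ω → MemLp w ⊤ (volume.restrict K)) ∧
        ∀ ψ : testFunctions ω, weakGradLinear hω hφ i ψ = ∫ A, w A * ψ.1 A := fun i =>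
      exists_density_of_locally_bounded hω _ fun K hK hKω => by
        obtain ⟨C, hC, hb⟩ := h K hK hKω
        exact ⟨C, hC, fun ψ hψ => hb ψ.1 ⟨ψ.2.1, ψ.2.2.1, hψ⟩ i⟩
    choose w hw hrep using key
    refine ⟨fun A i => -w i A, fun K hK hKω => memLp_pi_iff.2 fun i => (hw i K hK hKω).neg, ?_⟩
    refine isDistributionalSolution_iff.2 fun ψ hψ i => ?_
    simp only [neg_mul, integral_neg, neg_neg]
    exact hrep i ⟨ψ, hψ⟩
  · rintro ⟨w, hw, hsol⟩ K hK hKω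
    rw [isDistributionalSolution_iff] at hsol
    have hwK := hw K hK hKω
    refine ⟨(eLpNorm w ⊤ (volume.restrict K)).toReal, ENNReal.toReal_nonneg, fun ψ hψ i => ?_⟩
    set C := (eLpNorm w ⊤ (volume.restrict K)).toReal with hCdef
    have e1 : ∫ A in K, w A i * ψ A = ∫ A, w A i * ψ A :=
      setIntegral_eq_integral_of_forall_compl_eq_zero fun A hA => by rw [hψ.eq_zero hA, mul_zero]
    have e2 : ∫ A in K, C * |ψ A| = ∫ A, C * |ψ A| :=
      setIntegral_eq_integral_of_forall_compl_eq_zero fun A hA => by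
        rw [hψ.eq_zero hA, abs_zero, mul_zero]
    have e3 : Integrable (fun A => C * |ψ A|) (volume.restrict K) :=
      ((memLp_one_iff_integrable.1 (hψ.memLp 1 (volume.restrict K))).abs).const_mul C
    rw [hsol ψ ⟨hψ.1, hψ.2.1, hψ.2.2.trans hKω⟩ i, abs_neg, ← integral_const_mul, ← e1, ← e2,
      ← Real.norm_eq_abs]
    refine norm_integral_le_of_norm_le e3 ?_
    filter_upwards [ae_le_eLpNormEssSup (f := w) (μ := volume.restrict K)] with A hA
    rw [norm_mul]
    refine mul_le_mul_of_nonneg_right ((norm_le_pi_norm (w A) i).trans ?_) (norm_nonneg _)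
    have h3 : ‖w A‖ₑ ≤ eLpNorm w ⊤ (volume.restrict K) := by rwa [eLpNorm_exponent_top]
    rw [← toReal_enorm]
    exact ENNReal.toReal_mono hwK.2.ne h3

/-! ### Horizontal fields, their flows and the quasidistance -/

/-- The combination `∑ vᵢ Xᵢ` of the fields on `𝕎`. -/
def field (v : WIdx n → ℝ) (A : W n) : W n := ∑ i, v i • X i A

theorem X_fst (i : WIdx n) (A : W n) : (X i A).1 = Pi.single i 1 := rfl

theorem field_fst (v : WIdx n → ℝ) (A : W n) : (field v A).1 = v := by
  ext j
  simp [field, Prod.fst_sum, X_fst, Finset.sum_apply, Pi.single_apply]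

theorem field_smul (s : ℝ) (v : WIdx n → ℝ) (A : W n) : field (s • v) A = s • field v A := by
  simp [field, Finset.smul_sum, mul_smul]

theorem field_single (i : WIdx n) (A : W n) : field (Pi.single i 1) A = X i A := by
  simp [field, Pi.single_apply, ite_smul]

theorem continuous_field (v : WIdx n → ℝ) : Continuous (field v) :=
  continuous_finsetSum _ fun i _ => (continuous_X i).const_smul (v i)

theorem toHeis_x (A : W n) (i : WIdx n) : (toHeis A).x i.1 = A.1 i := by
  simp [toHeis, i.2]

theorem toHeis_x_inl (A : W n) : (toHeis A).x (Sum.inl 0) = 0 := by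
  simp [toHeis]

theorem X_yIdx (A : W n) : X (yIdx n) A = (Pi.single (yIdx n) 1, 0) := by
  simp [X, yIdx, toHeis]

theorem sum_WIdx (f : Fin n ⊕ Fin n → ℝ) (h : f (Sum.inl 0) = 0) :
    ∑ i : WIdx n, f i.1 = ∑ j : Fin n, (f (Sum.inl j) + f (Sum.inr j)) := by
  rw [← Finset.sum_subtype (Finset.univ.filter fun i : Fin n ⊕ Fin n => i ≠ Sum.inl 0)
    (by simp) f, Finset.sum_filter_of_ne (fun i _ hi => by rintro rfl; exact hi h),
    Fintype.sum_sum_type, Finset.sum_add_distrib]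

theorem field_snd (v : WIdx n → ℝ) (A : W n) : (field v A).2 = (1 / 2) * ∑ j : Fin n,
    ((toHeis A).x (Sum.inl j) * (toHeis (v, 0)).x (Sum.inr j) -
      (toHeis A).x (Sum.inr j) * (toHeis (v, 0)).x (Sum.inl j)) := by
  have h1 : (field v A).2 = ∑ i : WIdx n, (toHeis (v, 0)).x i.1 *
      (match i.1 with
        | Sum.inl j => -((toHeis A).x (Sum.inr j) / 2)
        | Sum.inr j => (toHeis A).x (Sum.inl j) / 2) := by
    simp only [field, Prod.snd_sum, Prod.smul_snd, smul_eq_mul, toHeis_x]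
    rfl
  rw [h1, sum_WIdx (fun i => (toHeis (v, 0)).x i * (match i with
        | Sum.inl j => -((toHeis A).x (Sum.inr j) / 2)
        | Sum.inr j => (toHeis A).x (Sum.inl j) / 2)) (by simp [toHeis_x_inl]), Finset.mul_sum]
  exact Finset.sum_congr rfl fun j _ => by ring

theorem toHeis_x_add (a b : WIdx n → ℝ) (s t r : ℝ) (i : Fin n ⊕ Fin n) :
    (toHeis (a + b, s)).x i = (toHeis (a, t)).x i + (toHeis (b, r)).x i := by
  by_cases h : i = Sum.inl 0 <;> simp [toHeis, h]

theorem toHeis_x_smul (c : ℝ) (b : WIdx n → ℝ) (s t : ℝ) (i : Fin n ⊕ Fin n) :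
    (toHeis (c • b, s)).x i = c * (toHeis (b, t)).x i := by
  by_cases h : i = Sum.inl 0 <;> simp [toHeis, h]

/-- The `t`-component of the field is a symplectic pairing of the position with `v`; moving the
position along `v` does not change it, by antisymmetry. Hence integral curves are straight lines and
the flow has an explicit formula. -/
theorem field_add_smul_field (s : ℝ) (v : WIdx n → ℝ) (A : W n) :
    field v (A + s • field v A) = field v A := by
  refine Prod.ext (by simp only [field_fst]) ?_
  rw [field_snd, field_snd]
  congr 1
  refine Finset.sum_congr rfl fun j _ => ?_
  have h : ∀ i, (toHeis (A + s • field v A)).x i =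
      (toHeis A).x i + s * (toHeis (v, 0)).x i := fun i => by
    have : A + s • field v A = (A.1 + s • v, A.2 + s * (field v A).2) := by
      ext <;> simp [field_fst]
    rw [this, toHeis_x_add _ _ _ A.2 0, toHeis_x_smul _ _ _ 0]
  rw [h, h]
  ring

/-- The quasidistance in terms of the fields `Xᵢ`. -/
theorem graphDist_eq_field (φ : W n → ℝ) (A B : W n) :
    graphDist φ A B = Real.sqrt (∑ i, (B.1 i - A.1 i) ^ 2) +
      Real.sqrt |B.2 - A.2 - (field (B.1 - A.1) A).2 -
        (1 / 2) * (φ A + φ B) * (B.1 (yIdx n) - A.1 (yIdx n))| := by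
  rw [graphDist_eq, field_snd]
  congr 3
  have h : ∀ i, (toHeis (B.1 - A.1, 0)).x i = (toHeis B).x i - (toHeis A).x i := fun i => by
    by_cases h : i = Sum.inl 0 <;> simp [toHeis, h]
  have h2 : ∑ j : Fin n, ((toHeis A).x (Sum.inl j) * (toHeis (B.1 - A.1, 0)).x (Sum.inr j) -
      (toHeis A).x (Sum.inr j) * (toHeis (B.1 - A.1, 0)).x (Sum.inl j)) =
      - ∑ j : Fin n, ((toHeis A).x (Sum.inr j) * (toHeis B).x (Sum.inl j) -
          (toHeis A).x (Sum.inl j) * (toHeis B).x (Sum.inr j)) := by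
    rw [← Finset.sum_neg_distrib]
    exact Finset.sum_congr rfl fun j _ => by rw [h, h]; ring
  rw [h2]
  ring

/-- The time-`s` flow of the field `∑ vᵢ Xᵢ`. -/
def flow (v : WIdx n → ℝ) (s : ℝ) : W n ≃ₜ W n where
  toFun A := A + s • field v A
  invFun A := A + (-s) • field v A
  left_inv A := by simp [field_add_smul_field]
  right_inv A := by
    have := field_add_smul_field (-s) v A
    simp only [this]
    simp
  continuous_toFun := continuous_id.add ((continuous_field v).const_smul s)
  continuous_invFun := continuous_id.add ((continuous_field v).const_smul (-s))

theorem flow_apply (v : WIdx n → ℝ) (s : ℝ) (A : W n) : flow v s A = A + s • field v A := rfl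

theorem flow_flow (v : WIdx n → ℝ) (s r : ℝ) (A : W n) :
    flow v s (flow v r A) = flow v (s + r) A := by
  rw [flow_apply, flow_apply, flow_apply, field_add_smul_field, add_smul]
  abel

theorem flow_zero (v : WIdx n → ℝ) (A : W n) : flow v 0 A = A := by simp [flow_apply]

/-- The flow translates the `z` coordinates and shifts `t` by an amount depending on `z` only, so it
is a skew product of translations. -/
theorem measurePreserving_flow (v : WIdx n → ℝ) (s : ℝ) :
    MeasurePreserving (flow v s) volume volume := by
  have hfield : ∀ A : W n, (field v A).2 = (field v (A.1, 0)).2 := fun A => by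
    rw [field_snd, field_snd]; rfl
  have hg : Continuous fun p : (WIdx n → ℝ) × ℝ => p.2 + s * (field v (p.1, 0)).2 :=
    continuous_snd.add (continuous_const.mul ((continuous_field v).comp
      (continuous_fst.prodMk continuous_const)).snd)
  have := (measurePreserving_add_right (volume : Measure (WIdx n → ℝ)) (s • v)).skew_product
    (μc := (volume : Measure ℝ)) (μd := volume)
    (g := fun z t => t + s * (field v (z, 0)).2) hg.measurable
    (ae_of_all _ fun z => (measurePreserving_add_right volume _).map_eq)
  have he : (flow v s : W n → W n) =
      fun p => (p.1 + s • v, p.2 + s * (field v (p.1, 0)).2) := by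
    funext A
    refine Prod.ext (by simp [flow_apply, field_fst]) ?_
    rw [flow_apply, Prod.snd_add, Prod.smul_snd, hfield]
    rfl
  rw [he]
  exact this

theorem integral_comp_flow (v : WIdx n → ℝ) (s : ℝ) (f : W n → ℝ) :
    ∫ A, f (flow v s A) = ∫ A, f A :=
  (measurePreserving_flow v s).integral_comp (flow v s).measurableEmbedding f

/-! ### Derivatives under the integral; Lipschitz bounds give weak bounds for the linear components
-/

theorem hasDerivAt_integral_mul_comp_line {α : Type*} [MeasurableSpace α] {μ : Measure α}
    {ψ : W n → ℝ} (hψ : ContDiff ℝ (⊤ : ℕ∞) ψ) (hc : HasCompactSupport ψ) {m : α → ℝ}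
    {P Q : α → W n} (hm : Measurable m) (hP : Measurable P) (hQ : Measurable Q)
    (hi : Integrable m μ) (hi' : Integrable (fun a => m a * ‖Q a‖) μ) :
    Integrable (fun a => m a * fderiv ℝ ψ (P a) (Q a)) μ ∧
    HasDerivAt (fun s : ℝ => ∫ a, m a * ψ (P a + s • Q a) ∂μ)
      (∫ a, m a * fderiv ℝ ψ (P a) (Q a) ∂μ) 0 := by
  have hψ' : Continuous (fderiv ℝ ψ) := hψ.continuous_fderiv (by simp)
  obtain ⟨M, hM⟩ := hψ'.bounded_above_of_compact_support (hc.fderiv ℝ)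
  obtain ⟨N, hN⟩ := hψ.continuous.bounded_above_of_compact_support hc
  have hline : ∀ s : ℝ, Measurable fun a => P a + s • Q a := fun s => hP.add (hQ.const_smul s)
  have hmeas : ∀ s : ℝ, AEStronglyMeasurable (fun a => m a * ψ (P a + s • Q a)) μ := fun s =>
    (hm.mul (hψ.continuous.measurable.comp (hline s))).aestronglyMeasurable
  -- The `s`-derivatives are dominated by `M |m| ‖Q‖`, with `M` a bound for the derivative of `ψ`.
  -- The parameter space is arbitrary so that a kinetic variable can be carried along.
  have key := hasDerivAt_integral_of_dominated_loc_of_deriv_le (μ := μ) (𝕜 := ℝ)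
    (F := fun s a => m a * ψ (P a + s • Q a))
    (F' := fun s a => m a * fderiv ℝ ψ (P a + s • Q a) (Q a)) (x₀ := 0) (s := univ)
    (bound := fun a => M * |m a * ‖Q a‖|) univ_mem (Eventually.of_forall hmeas) ?_ ?_ ?_ ?_ ?_
  · simpa using key
  · refine (hi.abs.const_mul N).mono' (hmeas 0) (ae_of_all _ fun a => ?_)
    rw [norm_mul, mul_comm]
    exact mul_le_mul_of_nonneg_right (hN _) (norm_nonneg _)
  · have h1 : Measurable fun a => (P a, Q a) := hP.prodMk hQ
    have h2 : Continuous fun p : W n × W n => fderiv ℝ ψ (p.1 + (0 : ℝ) • p.2) p.2 :=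
      (hψ'.comp (continuous_fst.add (continuous_snd.const_smul (0 : ℝ)))).clm_apply continuous_snd
    exact (hm.mul (h2.measurable.comp h1)).aestronglyMeasurable
  · refine ae_of_all _ fun a s _ => ?_
    rw [norm_mul, abs_mul, abs_norm]
    have h1 := ((fderiv ℝ ψ (P a + s • Q a)).le_opNorm (Q a)).trans
      (mul_le_mul_of_nonneg_right (hM (P a + s • Q a)) (norm_nonneg (Q a)))
    have h2 := mul_le_mul_of_nonneg_left h1 (norm_nonneg (m a))
    refine h2.trans (le_of_eq ?_)
    rw [Real.norm_eq_abs]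
    ring
  · exact (hi'.abs).const_mul M
  · refine ae_of_all _ fun a s _ => ?_
    have h1 : HasDerivAt (fun s : ℝ => P a + s • Q a) (Q a) s := by
      simpa using ((hasDerivAt_id s).smul_const (Q a)).const_add (P a)
    exact (((hψ.differentiable (by simp)) _).hasFDerivAt.comp_hasDerivAt s h1).const_mul (m a)

/-- Nothing is known of `φ` outside `ω`. Cutting it off outside a compact set gives a measurable,
bounded, integrable function on the whole space, with the same integrals against functions vanishing
off that set. -/
theorem measurable_truncation {φ : W n → ℝ} {K : Set (W n)} (hK : IsCompact K)
    (hφ : ContinuousOn φ K) : Measurable (K.indicator φ) := by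
  classical
  rw [← piecewise_eq_indicator]
  exact hφ.measurable_piecewise continuousOn_const hK.measurableSet

theorem exists_bound_truncation {φ : W n → ℝ} {K : Set (W n)} (hK : IsCompact K)
    (hφ : ContinuousOn φ K) : ∃ M, 0 ≤ M ∧ ∀ A, |K.indicator φ A| ≤ M := by
  obtain ⟨M, hM⟩ := hK.exists_bound_of_continuousOn hφ
  refine ⟨max M 0, le_max_right _ _, fun A => ?_⟩
  by_cases h : A ∈ K
  · simpa [h] using Or.inl (hM A h)
  · simp [h]

theorem integrable_truncation {φ : W n → ℝ} {K : Set (W n)} (hK : IsCompact K)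
    (hφ : ContinuousOn φ K) : Integrable (K.indicator φ) :=
  (integrable_indicator_iff hK.measurableSet).2 (hφ.integrableOn_compact hK)

theorem integrable_truncation_mul {φ g : W n → ℝ} {K : Set (W n)} (hK : IsCompact K)
    (hφ : ContinuousOn φ K) (hg : Continuous g) : Integrable fun A => K.indicator φ A * g A := by
  have := integrable_truncation hK (hφ.mul hg.continuousOn)
  refine this.congr (ae_of_all _ fun A => ?_)
  by_cases h : A ∈ K <;> simp [h]

theorem hasDerivAt_integral_flow {φ f : W n → ℝ} {K : Set (W n)} (hK : IsCompact K)
    (hφ : ContinuousOn φ K) (hf : IsTestFunction f K) (v : WIdx n → ℝ) :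
    HasDerivAt (fun s => ∫ A, K.indicator φ A * f (flow v s A))
      (∫ A, φ A * fderiv ℝ f A (field v A)) 0 := by
  have h := hasDerivAt_integral_mul_comp_line hf.1 hf.2.1 (μ := volume)
    (measurable_truncation hK hφ)
    measurable_id (continuous_field v).measurable (integrable_truncation hK hφ)
    (integrable_truncation_mul hK hφ (continuous_field v).norm)
  have e : ∫ A, φ A * fderiv ℝ f A (field v A) =
      ∫ A, K.indicator φ A * fderiv ℝ f (id A) (field v A) := by
    refine integral_congr_ae (ae_of_all _ fun A => ?_)
    by_cases hA : A ∈ K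
    · simp [hA]
    · simp [hA, hf.fderiv_eq_zero hA]
  rw [e]
  exact h.2

theorem norm_fst_le_graphDist (φ : W n → ℝ) (A B : W n) : ‖B.1 - A.1‖ ≤ graphDist φ A B := by
  rw [graphDist_eq]
  refine le_add_of_le_of_nonneg ?_ (Real.sqrt_nonneg _)
  refine (pi_norm_le_iff_of_nonneg (Real.sqrt_nonneg _)).2 fun i => ?_
  refine Real.abs_le_sqrt ?_
  exact Finset.single_le_sum (f := fun i => (B.1 i - A.1 i) ^ 2) (fun i _ => sq_nonneg _)
    (Finset.mem_univ i)

theorem sqrt_sum_single (i : WIdx n) (s : ℝ) :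
    Real.sqrt (∑ j, ((s • Pi.single i (1 : ℝ) : WIdx n → ℝ) j) ^ 2) = |s| := by
  have : ∑ j, ((s • Pi.single i (1 : ℝ) : WIdx n → ℝ) j) ^ 2 = s ^ 2 := by
    simp [Pi.single_apply, ite_pow]
  rw [this, Real.sqrt_sq_eq_abs]

/-- Along `Xᵢ` the `t`-displacement is exactly that of the field and `x_{n+1}` is constant, so the
vertical part of the quasidistance vanishes. -/
theorem graphDist_flow (φ : W n → ℝ) (A : W n) {i : WIdx n} (hi : i ≠ yIdx n) (s : ℝ) :
    graphDist φ A (flow (Pi.single i 1) s A) = |s| := by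
  have h1 : (flow (Pi.single i 1) s A).1 - A.1 = s • Pi.single i 1 := by
    simp [flow_apply, field_fst]
  have h2 : ∀ j, (flow (Pi.single i 1) s A).1 j - A.1 j = (s • Pi.single i (1 : ℝ) : WIdx n → ℝ) j :=
    fun j => by rw [← h1]; rfl
  rw [graphDist_eq_field, h1, field_smul]
  simp only [h2, sqrt_sum_single]
  simp [flow_apply, hi.symm]

theorem graphDist_line (φ : W n → ℝ) (A : W n) (s q : ℝ) :
    graphDist φ A (A + s • ((Pi.single (yIdx n) 1, q) : W n)) =
      |s| + Real.sqrt |s * q - (1 / 2) *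
        (φ A + φ (A + s • ((Pi.single (yIdx n) 1, q) : W n))) * s| := by
  set B : W n := A + s • ((Pi.single (yIdx n) 1, q) : W n) with hB
  have h1 : B.1 - A.1 = s • Pi.single (yIdx n) 1 := by simp [hB]
  have h2 : ∀ j, B.1 j - A.1 j = (s • Pi.single (yIdx n) (1 : ℝ) : WIdx n → ℝ) j :=
    fun j => by rw [← h1]; rfl
  rw [graphDist_eq_field, h1, field_smul, field_single, X_yIdx]
  simp only [h2, sqrt_sum_single]
  simp [hB]

theorem exists_compact_thickening {ω K : Set (W n)} (hω : IsOpen ω) (hK : IsCompact K)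
    (h : K ⊆ ω) : ∃ K' δ, IsCompact K' ∧ K' ⊆ ω ∧ K ⊆ K' ∧ 0 < δ ∧
      ∀ A ∈ K, ∀ B, dist B A < δ → B ∈ K' := by
  obtain ⟨K', hK', hKK', hK'ω⟩ := exists_compact_between hK hω h
  obtain ⟨δ, hδ, hsub⟩ := hK.exists_thickening_subset_open isOpen_interior hKK'
  exact ⟨K', δ, hK', hK'ω, hKK'.trans interior_subset, hδ, fun A hA B hB =>
    interior_subset (hsub (mem_thickening_iff.2 ⟨A, hA, hB⟩))⟩

/-- The integral is the derivative at zero of `s ↦ ∫ φ · (ψ ∘ flow)`. Invariance of volume moves the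
flow onto `φ`, whose increments are at most `L |s|` by `graphDist_flow`. The margin `δ` keeps the
moved points in `K'`. -/
theorem abs_integral_X_le {φ ψ : W n → ℝ} {K K' : Set (W n)} {L δ : ℝ} (hK : IsCompact K)
    (hK' : IsCompact K') (hKK' : K ⊆ K') (hδ : 0 < δ)
    (hth : ∀ A ∈ K, ∀ B, dist B A < δ → B ∈ K') (hφ : ContinuousOn φ K') (hL : 0 < L)
    (hlip : ∀ A ∈ K', ∀ B ∈ K', |φ A - φ B| ≤ L * graphDist φ A B)
    (hψ : IsTestFunction ψ K) {i : WIdx n} (hi : i ≠ yIdx n) :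
    |∫ A, φ A * fderiv ℝ ψ A (X i A)| ≤ L * ∫ A, |ψ A| := by
  set Φ := K'.indicator φ with hΦ
  set v : WIdx n → ℝ := Pi.single i 1 with hv
  have hΦm : Measurable Φ := measurable_truncation hK' hφ
  obtain ⟨M, hM, hΦM⟩ := exists_bound_truncation hK' hφ
  have hψi : Integrable ψ := memLp_one_iff_integrable.1 (hψ.memLp 1 volume)
  have hder := hasDerivAt_integral_flow hK' hφ
    (f := ψ) ⟨hψ.1, hψ.2.1, hψ.2.2.trans hKK'⟩ v
  simp only [hv, field_single] at hder
  rw [← Real.norm_eq_abs]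
  refine hder.le_of_lip' (mul_nonneg hL.le (integral_nonneg fun A => abs_nonneg _)) ?_
  obtain ⟨B, hB⟩ := hK.exists_bound_of_continuousOn (continuous_field v).continuousOn
  have hsmall : ∀ᶠ s : ℝ in 𝓝 0, |s| * (|B| + 1) < δ := by
    have : Tendsto (fun s : ℝ => |s| * (|B| + 1)) (𝓝 0) (𝓝 (|(0 : ℝ)| * (|B| + 1))) :=
      (continuous_abs.mul continuous_const).tendsto 0
    rw [abs_zero, zero_mul] at this
    exact this.eventually (gt_mem_nhds hδ)
  filter_upwards [hsmall] with s hs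
  have hint : ∀ r, Integrable fun A => Φ (flow v r A) * ψ A := fun r =>
    hψi.bdd_mul (hΦm.comp (flow v r).continuous.measurable).aestronglyMeasurable
      (ae_of_all _ fun A => hΦM _)
  have hshift : ∀ r, ∫ A, Φ A * ψ (flow v r A) = ∫ A, Φ (flow v (-r) A) * ψ A := fun r => by
    rw [← integral_comp_flow v r fun A => Φ (flow v (-r) A) * ψ A]
    simp only [flow_flow, neg_add_cancel, flow_zero]
  rw [← hv, ← hΦ, hshift, hshift, neg_zero, ← integral_sub (hint _) (hint _), sub_zero, mul_right_comm,
    ← integral_const_mul]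
  refine norm_integral_le_of_norm_le (hψi.abs.const_mul _) (ae_of_all _ fun A => ?_)
  by_cases hA : A ∈ K
  · have hA' : flow v (-s) A ∈ K' := by
      refine hth A hA _ ?_
      rw [flow_apply, dist_self_add_left, norm_smul, norm_neg]
      refine lt_of_le_of_lt ?_ hs
      exact mul_le_mul_of_nonneg_left ((hB A hA).trans ((le_abs_self B).trans (by linarith)))
        (norm_nonneg _)
    have h1 := hlip A (hKK' hA) _ hA'
    rw [graphDist_flow φ A hi, abs_neg, abs_sub_comm] at h1
    rw [flow_zero, ← sub_mul, norm_mul]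
    simp only [hΦ, indicator_of_mem hA', indicator_of_mem (hKK' hA)]
    exact mul_le_mul_of_nonneg_right h1 (norm_nonneg _)
  · simp [hψ.eq_zero hA]

/-! ### Kinetic formulation of the nonlinear component -/

/-- The kinetic function `1_{q ≤ p} - 1_{q ≤ 0}` of the value `p`. -/
def kinetic (q p : ℝ) : ℝ := (if q ≤ p then 1 else 0) - (if q ≤ 0 then 1 else 0)

theorem kinetic_zero (q : ℝ) : kinetic q 0 = 0 := sub_self _

theorem abs_kinetic_le (q p : ℝ) : |kinetic q p| ≤ 1 := by
  unfold kinetic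
  split_ifs <;> norm_num

theorem kinetic_eq_zero {q p M : ℝ} (hp : |p| ≤ M) (hq : M < |q|) : kinetic q p = 0 := by
  unfold kinetic
  rw [abs_le] at hp
  rcases lt_abs.1 hq with h | h
  · rw [if_neg (by linarith), if_neg (by linarith), sub_zero]
  · rw [if_pos (by linarith), if_pos (by linarith), sub_self]

theorem measurable_kinetic {α : Type*} [MeasurableSpace α] {f g : α → ℝ} (hf : Measurable f)
    (hg : Measurable g) : Measurable fun a => kinetic (f a) (g a) :=
  (Measurable.ite (measurableSet_le hf hg) measurable_const measurable_const).sub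
    (Measurable.ite (measurableSet_le hf measurable_const) measurable_const measurable_const)

/-- As a function of `q` the kinetic function is the signed indicator of the interval between 0 and
`p`; its moments `p` and `p² / 2` are the density and the flux of the balance law. -/
theorem integral_kinetic_mul (p a b : ℝ) :
    ∫ q, kinetic q p * (a + q * b) = p * a + (1 / 2) * p ^ 2 * b := by
  have h1 : ∀ q, kinetic q p * (a + q * b) = (Ioc 0 p).indicator (fun q => a + q * b) q -
      (Ioc p 0).indicator (fun q => a + q * b) q := fun q => by
    unfold kinetic
    simp only [indicator, mem_Ioc]
    split_ifs <;> grind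
  have hc : Continuous fun q : ℝ => a + q * b := by fun_prop
  have hi : ∀ s t : ℝ, Integrable ((Ioc s t).indicator fun q => a + q * b) := fun s t =>
    (integrable_indicator_iff measurableSet_Ioc).2
      ((hc.continuousOn.integrableOn_compact isCompact_Icc).mono_set Ioc_subset_Icc_self)
  simp_rw [h1]
  rw [integral_sub (hi _ _) (hi _ _), integral_indicator measurableSet_Ioc,
    integral_indicator measurableSet_Ioc]
  -- The difference of the two integrals is the oriented integral by definition.
  change ∫ q in (0 : ℝ)..p, (a + q * b) = _
  rw [intervalIntegral.integral_add (by simp) ((by fun_prop : Continuous fun q : ℝ => q * b).intervalIntegrable 0 p),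
    intervalIntegral.integral_mul_const, intervalIntegral.integral_const, integral_id, smul_eq_mul]
  ring

/-- The two kinetic functions can differ only at levels `q` between `p` and `p₀`, which the
hypothesis confines to distance `c` from `p₀`. -/
theorem abs_kinetic_sub_le {q p p₀ c : ℝ} (h : p ≤ q ∧ q ≤ p₀ ∨ p₀ ≤ q ∧ q ≤ p → |q - p₀| ≤ c) :
    |kinetic q p - kinetic q p₀| ≤ (Icc (p₀ - c) (p₀ + c)).indicator 1 q := by
  by_cases hc : |q - p₀| ≤ c
  · rw [abs_le] at hc
    have hmem : q ∈ Icc (p₀ - c) (p₀ + c) := ⟨by linarith, by linarith⟩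
    rw [indicator_of_mem hmem]
    unfold kinetic
    split_ifs <;> norm_num
  · have h' : ¬ (p ≤ q ∧ q ≤ p₀ ∨ p₀ ≤ q ∧ q ≤ p) := fun h'' => hc (h h'')
    have : kinetic q p - kinetic q p₀ = 0 := by
      unfold kinetic
      split_ifs <;> grind
    rw [this, abs_zero]
    exact indicator_nonneg (fun _ _ => zero_le_one) _

/-- The direction `∂_{x_{n+1}} + q ∂_t`. -/
def lineDir (n : ℕ) [NeZero n] (q : ℝ) : W n := (Pi.single (yIdx n) 1, q)

theorem lineDir_eq (q : ℝ) (A : W n) : lineDir n q = X (yIdx n) A + q • T := by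
  simp [lineDir, X_yIdx, T]

theorem continuous_lineDir : Continuous (lineDir n) := continuous_const.prodMk continuous_id

theorem norm_lineDir_le {q M : ℝ} (h : |q| ≤ M) : ‖lineDir n q‖ ≤ 1 + M := by
  have h1 := abs_nonneg q
  refine max_le ?_ (h.trans (by linarith))
  refine (pi_norm_le_iff_of_nonneg (by linarith)).2 fun j => ?_
  simp only [lineDir, Pi.single_apply]
  split_ifs
  · simpa using h1.trans h
  · simpa using by linarith

/-- The slope `q` of the line lies between the end values, so it differs from their mean by at most
half the jump `D`, and the vertical part of the quasidistance is at most `√(|s| D / 2)`. The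
inequality of the means gives `D ≤ L |s| + D / 2 + L² |s| / 2`, and `D / 2` is absorbed. -/
theorem abs_sub_le_of_between {φ : W n → ℝ} {A : W n} {L s q : ℝ} (hL : 0 < L)
    (hlip : |φ A - φ (A + s • lineDir n q)| ≤ L * graphDist φ A (A + s • lineDir n q))
    (hq : φ (A + s • lineDir n q) ≤ q ∧ q ≤ φ A ∨ φ A ≤ q ∧ q ≤ φ (A + s • lineDir n q)) :
    |q - φ A| ≤ (2 * L + L ^ 2) * |s| := by
  unfold lineDir at *
  rw [graphDist_line] at hlip
  set p₀ := φ A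
  set p := φ (A + s • ((Pi.single (yIdx n) 1, q) : W n))
  have h1 : |q - p₀| ≤ |p₀ - p| := by
    rcases hq with h | h
    · rw [abs_of_nonpos (by linarith), abs_of_nonneg (by linarith)]; linarith
    · rw [abs_of_nonneg (by linarith), abs_of_nonpos (by linarith)]; linarith
  have h2 : |s * q - 1 / 2 * (p₀ + p) * s| ≤ |s| * (|p₀ - p| / 2) := by
    rw [show s * q - 1 / 2 * (p₀ + p) * s = s * (q - 1 / 2 * (p₀ + p)) by ring, abs_mul]
    refine mul_le_mul_of_nonneg_left ?_ (abs_nonneg _)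
    rcases hq with h | h
    · rw [abs_of_nonneg (by linarith : 0 ≤ p₀ - p), abs_le]; constructor <;> linarith
    · rw [abs_of_nonpos (by linarith : p₀ - p ≤ 0), abs_le]; constructor <;> linarith
  have h3 : L * √|s * q - 1 / 2 * (p₀ + p) * s| ≤ |p₀ - p| / 2 + L ^ 2 * |s| / 2 := by
    set r := √|s * q - 1 / 2 * (p₀ + p) * s| with hr
    have h4 : r ^ 2 ≤ |s| * (|p₀ - p| / 2) := by
      rw [hr, Real.sq_sqrt (abs_nonneg _)]; exact h2
    refine abs_le_of_sq_le_sq' ?_ (by positivity) |>.2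
    have : (L * r) ^ 2 ≤ L ^ 2 * (|s| * (|p₀ - p| / 2)) := by
      rw [mul_pow]; gcongr
    nlinarith [sq_nonneg (|p₀ - p| - L ^ 2 * |s|), mul_nonneg (abs_nonneg (p₀ - p)) (mul_nonneg (sq_nonneg L) (abs_nonneg s))]
  linarith

/-- The weak derivative is the derivative at `s = 0` of a kinetic integral. By
`abs_sub_le_of_between`, the increment at `A` comes only from levels within `c = (2L + L²)|s|` of `φ
A`, an interval of length `2c`; this is the origin of the factor 2. -/
theorem abs_weakGrad_yIdx_le {φ ψ : W n → ℝ} {K K' : Set (W n)} {L δ : ℝ}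
    (hK' : IsCompact K') (hKK' : K ⊆ K') (hδ : 0 < δ)
    (hth : ∀ A ∈ K, ∀ B, dist B A < δ → B ∈ K') (hφ : ContinuousOn φ K') (hL : 0 < L)
    (hlip : ∀ A ∈ K', ∀ B ∈ K', |φ A - φ B| ≤ L * graphDist φ A B)
    (hψ : IsTestFunction ψ K) :
    |weakGrad φ (yIdx n) ψ| ≤ 2 * (2 * L + L ^ 2) * ∫ A, |ψ A| := by
  set Φ := K'.indicator φ with hΦ
  have hΦm : Measurable Φ := measurable_truncation hK' hφ
  obtain ⟨M, hM, hΦM⟩ := exists_bound_truncation hK' hφ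
  have hψi : Integrable ψ := memLp_one_iff_integrable.1 (hψ.memLp 1 volume)
  set μ := (volume : Measure (W n)).prod (volume : Measure ℝ) with hμ
  let m : W n × ℝ → ℝ := fun a => kinetic a.2 (Φ a.1)
  have hm : Measurable m := measurable_kinetic measurable_snd (hΦm.comp measurable_fst)
  set S := K' ×ˢ Icc (-M) M with hS
  have hScomp : IsCompact S := hK'.prod isCompact_Icc
  have hmS : ∀ a ∉ S, m a = 0 := fun a ha => by
    by_cases h1 : a.1 ∈ K'
    · refine kinetic_eq_zero (hΦM _) (not_le.1 fun h2 => ha ⟨h1, abs_le.1 h2⟩)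
    · simp only [m, hΦ, indicator_of_notMem h1, kinetic_zero]
  have hSi : ∀ c : ℝ, Integrable (S.indicator fun _ => c) μ := fun c =>
    (integrable_indicator_iff hScomp.measurableSet).2
      (integrableOn_const hScomp.measure_lt_top.ne)
  have hi : Integrable m μ := (hSi 1).mono' hm.aestronglyMeasurable (ae_of_all _ fun a => by
    by_cases ha : a ∈ S
    · rw [indicator_of_mem ha]; exact abs_kinetic_le _ _
    · rw [hmS a ha, indicator_of_notMem ha, norm_zero])
  have hQ : Measurable fun a : W n × ℝ => lineDir n a.2 :=
    continuous_lineDir.measurable.comp measurable_snd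
  have hi' : Integrable (fun a => m a * ‖lineDir n a.2‖) μ :=
    (hSi (1 + M)).mono' (hm.mul hQ.norm).aestronglyMeasurable (ae_of_all _ fun a => by
      by_cases ha : a ∈ S
      · rw [indicator_of_mem ha, norm_mul, norm_norm]
        have h1 := norm_lineDir_le (n := n) (abs_le.2 ha.2)
        have h2 : ‖m a‖ ≤ 1 := abs_kinetic_le _ _
        calc ‖m a‖ * ‖lineDir n a.2‖ ≤ 1 * (1 + M) := by gcongr
          _ = 1 + M := one_mul _
      · simp [hmS a ha, ha])
  obtain ⟨hdi, hder⟩ := hasDerivAt_integral_mul_comp_line hψ.1 hψ.2.1 hm measurable_fst hQ hi hi'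
  have hval : ∫ a, m a * fderiv ℝ ψ a.1 (lineDir n a.2) ∂μ = weakGrad φ (yIdx n) ψ := by
    rw [integral_prod _ hdi]
    refine integral_congr_ae (ae_of_all _ fun A => ?_)
    have h1 : ∀ q, m (A, q) * fderiv ℝ ψ A (lineDir n q) =
        kinetic q (Φ A) * (fderiv ℝ ψ A (X (yIdx n) A) + q * fderiv ℝ ψ A T) := fun q => by
      rw [lineDir_eq q A, map_add, map_smul, smul_eq_mul]
    simp only [h1, integral_kinetic_mul]
    by_cases hA : A ∈ K
    · simp [hΦ, hKK' hA]
    · simp [hψ.fderiv_eq_zero hA]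
  rw [hval] at hder
  rw [← Real.norm_eq_abs]
  have hpos : 0 ≤ ∫ A, |ψ A| := integral_nonneg fun A => abs_nonneg _
  refine hder.le_of_lip' (by positivity) ?_
  have hsmall : ∀ᶠ s : ℝ in 𝓝 0, |s| * (1 + M) < δ := by
    have : Tendsto (fun s : ℝ => |s| * (1 + M)) (𝓝 0) (𝓝 (|(0 : ℝ)| * (1 + M))) :=
      (continuous_abs.mul continuous_const).tendsto 0
    rw [abs_zero, zero_mul] at this
    exact this.eventually (gt_mem_nhds hδ)
  filter_upwards [hsmall] with s hs
  have hline : ∀ r : ℝ, Measurable fun a : W n × ℝ => a.1 + r • lineDir n a.2 := fun r =>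
    measurable_fst.add (hQ.const_smul r)
  have hdom : ∀ N : ℝ, Integrable (fun a : W n × ℝ => |ψ a.1| * (Icc (-N) N).indicator 1 a.2) μ :=
    fun N => hψi.abs.mul_prod ((integrable_indicator_iff measurableSet_Icc).2
      (integrableOn_const isCompact_Icc.measure_lt_top.ne))
  have hψ1 : Measurable fun a : W n × ℝ => ψ a.1 :=
    hψ.1.continuous.measurable.comp measurable_fst
  have hint : ∀ r : ℝ, Integrable
      (fun a : W n × ℝ => kinetic a.2 (Φ (a.1 + r • lineDir n a.2)) * ψ a.1) μ := fun r =>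
    (hdom M).mono' ((measurable_kinetic measurable_snd (hΦm.comp (hline r))).mul
      hψ1).aestronglyMeasurable
      (ae_of_all _ fun a => by
        rw [norm_mul, mul_comm]
        refine mul_le_mul_of_nonneg_left ?_ (norm_nonneg _)
        by_cases ha : a.2 ∈ Icc (-M) M
        · rw [indicator_of_mem ha]; exact abs_kinetic_le _ _
        · rw [kinetic_eq_zero (hΦM _) (not_le.1 fun h => ha (abs_le.1 h)), indicator_of_notMem ha,
            norm_zero])
  have hint' : ∀ r : ℝ, Integrable
      (fun a : W n × ℝ => m a * ψ (a.1 + r • lineDir n a.2)) μ := fun r => by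
    obtain ⟨N, hN⟩ := hψ.1.continuous.bounded_above_of_compact_support hψ.2.1
    exact hi.mul_bdd (c := N) (hψ.1.continuous.measurable.comp (hline r)).aestronglyMeasurable
      (ae_of_all _ fun a => hN _)
  -- For fixed `q` the direction is a constant vector, so with `q` as the outer variable in Fubini
  -- the invariance of Lebesgue measure applies in `A`.
  have hshift : ∀ r : ℝ, ∫ a, m a * ψ (a.1 + r • lineDir n a.2) ∂μ =
      ∫ a : W n × ℝ, kinetic a.2 (Φ (a.1 + (-r) • lineDir n a.2)) * ψ a.1 ∂μ := fun r => by
    rw [integral_prod_symm _ (hint' r), integral_prod_symm _ (hint (-r))]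
    refine integral_congr_ae (ae_of_all _ fun q => ?_)
    have := integral_add_right_eq_self (μ := (volume : Measure (W n)))
      (fun A => m (A, q) * ψ (A + r • lineDir n q)) ((-r) • lineDir n q)
    simp only [m] at this ⊢
    rw [← this]
    refine integral_congr_ae (ae_of_all _ fun A => ?_)
    simp
  set c := (2 * L + L ^ 2) * |s| with hc
  have hc0 : 0 ≤ c := by positivity
  have hbd : ∀ a : W n × ℝ, ‖kinetic a.2 (Φ (a.1 + (-s) • lineDir n a.2)) * ψ a.1 -
      kinetic a.2 (Φ (a.1 + (-0 : ℝ) • lineDir n a.2)) * ψ a.1‖ ≤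
      |ψ a.1| * (Icc (Φ a.1 - c) (Φ a.1 + c)).indicator 1 a.2 := fun ⟨A, q⟩ => by
    by_cases hA : A ∈ K
    · rw [← sub_mul, norm_mul, mul_comm]
      refine mul_le_mul_of_nonneg_left ?_ (abs_nonneg _)
      simp only [neg_zero, zero_smul, add_zero]
      by_cases hq : |q| ≤ M
      · have hA' : A + (-s) • lineDir n q ∈ K' := by
          refine hth A hA _ ?_
          rw [dist_self_add_left, norm_smul, norm_neg]
          exact (mul_le_mul_of_nonneg_left (norm_lineDir_le hq) (norm_nonneg _)).trans_lt hs
        refine abs_kinetic_sub_le fun h => ?_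
        simp only [hΦ, indicator_of_mem hA', indicator_of_mem (hKK' hA)] at h ⊢
        have := abs_sub_le_of_between hL (hlip A (hKK' hA) _ hA') h
        rwa [abs_neg] at this
      · rw [kinetic_eq_zero (hΦM _) (not_le.1 hq), kinetic_eq_zero (hΦM _) (not_le.1 hq), sub_self,
          norm_zero]
        exact indicator_nonneg (fun _ _ => zero_le_one) _
    · simp [hψ.eq_zero hA]
  have hbi : Integrable
      (fun a : W n × ℝ => |ψ a.1| * (Icc (Φ a.1 - c) (Φ a.1 + c)).indicator 1 a.2) μ := by
    have hset : MeasurableSet {a : W n × ℝ | a.2 ∈ Icc (Φ a.1 - c) (Φ a.1 + c)} :=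
      (measurableSet_le ((hΦm.comp measurable_fst).sub_const c) measurable_snd).inter
        (measurableSet_le measurable_snd ((hΦm.comp measurable_fst).add_const c))
    have hmeas : Measurable fun a : W n × ℝ =>
        (Icc (Φ a.1 - c) (Φ a.1 + c)).indicator (1 : ℝ → ℝ) a.2 :=
      (measurable_const (a := (1 : ℝ))).indicator hset
    refine (hdom (M + c)).mono' (hψ1.abs.mul hmeas).aestronglyMeasurable (ae_of_all _ fun a => ?_)
    rw [norm_mul, Real.norm_eq_abs, abs_abs]
    refine mul_le_mul_of_nonneg_left ?_ (abs_nonneg _)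
    have hnn : 0 ≤ (Icc (Φ a.1 - c) (Φ a.1 + c)).indicator (1 : ℝ → ℝ) a.2 :=
      indicator_nonneg (fun _ _ => zero_le_one) _
    rw [Real.norm_of_nonneg hnn]
    refine indicator_le_indicator_of_subset (fun q hq => ?_) (fun _ => zero_le_one) _
    have := abs_le.1 (hΦM a.1)
    exact ⟨by linarith [hq.1], by linarith [hq.2]⟩
  rw [hshift, hshift, ← integral_sub (hint _) (hint _)]
  refine (norm_integral_le_of_norm_le hbi (ae_of_all _ hbd)).trans (le_of_eq ?_)
  rw [integral_prod _ hbi]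
  have hin : ∀ A : W n, ∫ q, |ψ A| * (Icc (Φ A - c) (Φ A + c)).indicator 1 q = |ψ A| * (2 * c) :=
    fun A => by
      rw [integral_const_mul, integral_indicator_one measurableSet_Icc]
      congr 1
      rw [Real.volume_real_Icc_of_le (by linarith)]
      ring
  simp only [hin]
  rw [integral_mul_const, sub_zero, Real.norm_eq_abs, hc]
  ring

theorem LocallyIntrinsicLipschitzOn.weaklyBounded {φ : W n → ℝ} {ω : Set (W n)} (hω : IsOpen ω)
    (hφ : ContinuousOn φ ω) (h : LocallyIntrinsicLipschitzOn φ ω) : WeaklyBounded φ ω := by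
  intro K hK hKω
  obtain ⟨K', δ, hK', hK'ω, hKK', hδ, hth⟩ := exists_compact_thickening hω hK hKω
  obtain ⟨L, hL, hlip⟩ := h K' (by rwa [hK'.isClosed.closure_eq])
    (by rwa [hK'.isClosed.closure_eq])
  refine ⟨L + 2 * (2 * L + L ^ 2), by positivity, fun ψ hψ i => ?_⟩
  have hpos : 0 ≤ ∫ A, |ψ A| := integral_nonneg fun A => abs_nonneg _
  rw [add_mul]
  by_cases hi : i = yIdx n
  · subst hi
    exact (abs_weakGrad_yIdx_le hK' hKK' hδ hth (hφ.mono hK'ω) hL hlip hψ).trans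
      (le_add_of_nonneg_left (by positivity))
  · have := abs_integral_X_le hK hK' hKK' hδ hth (hφ.mono hK'ω) hL hlip hψ hi
    simp only [weakGrad, hi, if_false, zero_mul, add_zero]
    exact this.trans (le_add_of_nonneg_right (by positivity))

/-! ### Mollification and Lipschitz bounds along the linear fields -/

/-- The mollification of a function by the bump function of index `k`. -/
def mollify (k : ℕ) (f : W n → ℝ) (A : W n) : ℝ := ∫ B, f B * bumpAt k A B

theorem mollify_eq_convolution (k : ℕ) (f : W n → ℝ) :
    mollify k f = convolution f ((bump k).normed volume) (ContinuousLinearMap.mul ℝ ℝ) volume :=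
  rfl

theorem abs_mollify_sub_le {k : ℕ} {f : W n → ℝ} (hf : AEStronglyMeasurable f volume) {A : W n}
    {ε : ℝ} (h : ∀ B, dist B A < (bump (n := n) k).rOut → |f B - f A| ≤ ε) :
    |mollify k f A - f A| ≤ ε := by
  have h1 := (bump (n := n) k).dist_normed_convolution_le (μ := volume) hf (x₀ := A) (ε := ε)
    fun B hB => h B hB
  rw [convolution_eq_swap] at h1
  have h2 : mollify k f A = ∫ B, (ContinuousLinearMap.lsmul ℝ ℝ)
      ((bump k).normed volume (A - B)) (f B) :=
    integral_congr_ae (ae_of_all _ fun B => by simp [bumpAt, mul_comm])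
  rw [h2]
  exact h1

theorem tendsto_mollify {f : W n → ℝ} (hf : AEStronglyMeasurable f volume) {A : W n}
    (hA : ContinuousAt f A) : Tendsto (fun k => mollify k f A) atTop (𝓝 (f A)) := by
  refine Metric.tendsto_atTop'.2 fun ε hε => ?_
  obtain ⟨δ, hδ, h⟩ := Metric.continuousAt_iff.1 hA (ε / 2) (half_pos hε)
  have := (tendsto_bump_rOut (n := n)).eventually (gt_mem_nhds hδ)
  obtain ⟨N, hN⟩ := eventually_atTop.1 this
  refine ⟨N, fun k hk => ?_⟩
  refine lt_of_le_of_lt (abs_mollify_sub_le hf fun B hB => ?_) (half_lt_self hε)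
  exact (h (hB.trans (hN k hk.le))).le

theorem abs_integral_field_le {φ ψ : W n → ℝ} {ω K : Set (W n)} {C : ℝ} (hω : IsOpen ω)
    (hφ : ContinuousOn φ ω) (hKω : K ⊆ ω)
    (hC : ∀ ψ : W n → ℝ, IsTestFunction ψ K → ∀ i, |weakGrad φ i ψ| ≤ C * ∫ A, |ψ A|)
    (hψ : IsTestFunction ψ K) {v : WIdx n → ℝ} (hv : v (yIdx n) = 0) :
    |∫ A, φ A * fderiv ℝ ψ A (field v A)| ≤ (∑ i, |v i|) * C * ∫ A, |ψ A| := by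
  have hψω : IsTestFunction ψ ω := ⟨hψ.1, hψ.2.1, hψ.2.2.trans hKω⟩
  have h1 : ∫ A, φ A * fderiv ℝ ψ A (field v A) = ∑ i, v i * weakGrad φ i ψ := by
    unfold weakGrad
    simp_rw [← integral_const_mul]
    rw [← integral_finsetSum _ fun i _ => (hψω.integrable_weakGrad hω hφ i).const_mul (v i)]
    refine integral_congr_ae (ae_of_all _ fun A => ?_)
    simp only [field, map_sum, map_smul, smul_eq_mul, Finset.mul_sum]
    refine Finset.sum_congr rfl fun i _ => ?_
    by_cases hi : i = yIdx n
    · rw [hi, hv]; ring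
    · rw [if_neg hi]; ring
  rw [h1, mul_assoc, Finset.sum_mul]
  refine (Finset.abs_sum_le_sum_abs _ _).trans (Finset.sum_le_sum fun i _ => ?_)
  rw [abs_mul]
  exact mul_le_mul_of_nonneg_left (hC ψ hψ i) (abs_nonneg _)

theorem contDiff_X (i : WIdx n) : ContDiff ℝ (⊤ : ℕ∞) (X i) := by
  have h : ∀ i : Fin n ⊕ Fin n, ContDiff ℝ (⊤ : ℕ∞) fun A : W n => (toHeis A).x i := fun i => by
    by_cases h : i = Sum.inl 0
    · simp only [toHeis, h]
      simpa using contDiff_const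
    · simp only [toHeis, ne_eq, h, not_false_eq_true, dif_pos]
      exact (contDiff_apply ℝ ℝ _).comp contDiff_fst
  rcases i with ⟨i | i, hi⟩
  · exact contDiff_const.prodMk ((h (Sum.inr i)).div_const 2).neg
  · exact contDiff_const.prodMk ((h (Sum.inl i)).div_const 2)

theorem contDiff_field (v : WIdx n → ℝ) : ContDiff ℝ (⊤ : ℕ∞) (field v) :=
  ContDiff.sum fun i _ => (contDiff_X i).const_smul (v i)

theorem contDiff_flow (v : WIdx n → ℝ) (s : ℝ) : ContDiff ℝ (⊤ : ℕ∞) (flow v s) :=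
  contDiff_id.add ((contDiff_field v).const_smul s)

theorem tsupport_comp_flow (f : W n → ℝ) (v : WIdx n → ℝ) (s : ℝ) :
    tsupport (fun A => f (flow v s A)) = flow v s ⁻¹' tsupport f := by
  have : Function.support (fun A => f (flow v s A)) = flow v s ⁻¹' Function.support f := rfl
  rw [tsupport, this, tsupport, (flow v s).preimage_closure]

theorem continuous_flow (v : WIdx n → ℝ) : Continuous fun p : W n × ℝ => flow v p.2 p.1 :=
  continuous_fst.add (continuous_snd.smul ((continuous_field v).comp continuous_fst))

theorem field_neg (v : WIdx n → ℝ) (A : W n) : field (-v) A = -field v A := by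
  simpa using field_smul (-1) v A

/-- Along the flow of a field with bounded weak derivative, `φ` is Lipschitz. -/
theorem abs_sub_flow_le {φ : W n → ℝ} {ω K : Set (W n)} {C : ℝ} (hω : IsOpen ω)
    (hφ : ContinuousOn φ ω) (hK : IsCompact K) (hKω : K ⊆ ω)
    (hC : ∀ ψ : W n → ℝ, IsTestFunction ψ K → ∀ i, |weakGrad φ i ψ| ≤ C * ∫ A, |ψ A|)
    {v : WIdx n → ℝ} (hv : v (yIdx n) = 0) {A : W n}
    (hA : ∀ s ∈ Icc (0 : ℝ) 1, flow v s A ∈ interior K) :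
    |φ (flow v 1 A) - φ A| ≤ (∑ i, |v i|) * C := by
  set Φ := K.indicator φ with hΦ
  have hΦm : Measurable Φ := measurable_truncation hK (hφ.mono hKω)
  obtain ⟨M, hM, hΦM⟩ := exists_bound_truncation hK (hφ.mono hKω)
  have hΦc : ∀ B ∈ interior K, ContinuousAt Φ B := fun B hB => by
    refine (hφ.continuousAt (hω.mem_nhds (hKω (interior_subset hB)))).congr ?_
    filter_upwards [isOpen_interior.mem_nhds hB] with D hD
    exact (indicator_of_mem (interior_subset hD) φ).symm
  have hA0 : A ∈ interior K := by simpa [flow_zero] using hA 0 (by simp)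
  have hA1 := hA 1 (by simp)
  -- By compactness of the time interval, points near `A` have their whole trajectory in the
  -- interior of `K`; hence all transported bumps are admissible test functions.
  have htube : ∀ᶠ B in 𝓝 A, ∀ s ∈ Icc (0 : ℝ) 1, flow v s B ∈ interior K :=
    isCompact_Icc.eventually_forall_of_forall_eventually fun s hs =>
      (continuous_flow v).continuousAt.eventually_mem (isOpen_interior.mem_nhds (hA s hs))
  obtain ⟨δ, hδ, hball⟩ := Metric.eventually_nhds_iff.1 htube
  have hlim : Tendsto (fun k => mollify k (fun B => Φ (flow v 1 B)) A - mollify k Φ A) atTop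
      (𝓝 (Φ (flow v 1 A) - Φ A)) := by
    refine (tendsto_mollify (hΦm.comp (flow v 1).continuous.measurable).aestronglyMeasurable
      ?_).sub (tendsto_mollify hΦm.aestronglyMeasurable (hΦc A hA0))
    exact ContinuousAt.comp (f := flow v 1) (hΦc _ hA1) (flow v 1).continuous.continuousAt
  have e1 : Φ (flow v 1 A) = φ (flow v 1 A) := indicator_of_mem (interior_subset hA1) φ
  have e2 : Φ A = φ A := indicator_of_mem (interior_subset hA0) φ
  rw [← e1, ← e2]
  refine le_of_tendsto hlim.abs ?_
  filter_upwards [(tendsto_bump_rOut (n := n)).eventually (gt_mem_nhds hδ)] with k hk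
  have hη : IsTestFunction (bumpAt k A) univ := isTestFunction_bumpAt (subset_univ _)
  have hf : ∀ s ∈ Icc (0 : ℝ) 1, IsTestFunction (fun B => bumpAt k A (flow v (-s) B)) K := by
    intro s hs
    have hsub : tsupport (fun B => bumpAt k A (flow v (-s) B)) ⊆ K := by
      rw [tsupport_comp_flow]
      intro B hB
      have h1 := hball (lt_of_le_of_lt (tsupport_bumpAt k A hB) hk) s hs
      rw [flow_flow, add_neg_cancel, flow_zero] at h1
      exact interior_subset h1
    exact ⟨hη.1.comp (contDiff_flow v _), hK.of_isClosed_subset (isClosed_tsupport _) hsub, hsub⟩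
  have hint : ∀ s, ∫ B, |bumpAt k A (flow v (-s) B)| = 1 := fun s => by
    rw [integral_comp_flow v (-s) fun B => |bumpAt k A B|]
    simp only [abs_of_nonneg (bumpAt_nonneg k A _), integral_bumpAt]
  -- `g` joins the mollification at `A` of `Φ` to that of `Φ ∘ flow v 1`. Its derivative is a weak
  -- derivative tested on a transported bump, which still has `L¹` norm one.
  let g : ℝ → ℝ := fun s => ∫ B, Φ B * bumpAt k A (flow v (-s) B)
  have hder : ∀ s ∈ Icc (0 : ℝ) 1, ∃ d, HasDerivAt g d s ∧ |d| ≤ (∑ i, |v i|) * C := by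
    intro s hs
    have h1 := hasDerivAt_integral_flow hK (hφ.mono hKω) (hf s hs) (-v)
    have h2 := abs_integral_field_le hω hφ hKω hC (hf s hs) (v := -v) (by simp [hv])
    rw [hint, mul_one] at h2
    refine ⟨_, ?_, by simpa using h2⟩
    -- The group law of the flow reduces the derivative at `s` to one at zero, with the transported
    -- bump as test function.
    have h3 : HasDerivAt (fun r => g (s + r)) (∫ B, φ B *
        fderiv ℝ (fun B => bumpAt k A (flow v (-s) B)) B (field (-v) B)) 0 := by
      convert h1 using 1
      funext r
      refine integral_congr_ae (ae_of_all _ fun B => ?_)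
      have : flow (-v) r B = flow v (-r) B := by simp [flow_apply, field_neg]
      simp only [this, flow_flow, neg_add]
      rfl
    have h4 := HasDerivAt.comp_add_const (f := fun r => g (s + r)) s (-s)
      (by rw [add_neg_cancel]; exact h3)
    simpa using h4
  choose! d hd hdb using hder
  have hmv := (convex_Icc (0 : ℝ) 1).norm_image_sub_le_of_norm_hasDerivWithin_le
    (fun s hs => (hd s hs).hasDerivWithinAt) hdb (left_mem_Icc.2 zero_le_one)
    (right_mem_Icc.2 zero_le_one)
  rw [sub_zero, norm_one, mul_one] at hmv
  have hg1 : g 1 = mollify k (fun B => Φ (flow v 1 B)) A := by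
    change ∫ B, Φ B * bumpAt k A (flow v (-1) B) = ∫ B, Φ (flow v 1 B) * bumpAt k A B
    rw [← integral_comp_flow v 1 fun B => Φ B * bumpAt k A (flow v (-1) B)]
    simp only [flow_flow, neg_add_cancel, flow_zero]
  have hg0 : g 0 = mollify k Φ A := by
    simp only [g, mollify, neg_zero, flow_zero]
  rw [← hg1, ← hg0]
  exact hmv

theorem contDiff_mollify (k : ℕ) {f : W n → ℝ} (hf : LocallyIntegrable f volume) :
    ContDiff ℝ (⊤ : ℕ∞) (mollify k f) :=
  (bump (n := n) k).hasCompactSupport_normed.contDiff_convolution_right (n := ⊤)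
    (ContinuousLinearMap.mul ℝ ℝ) hf (bump k).contDiff_normed

/-- The derivative of a mollification. -/
theorem fderiv_mollify (k : ℕ) {f : W n → ℝ} (hf : LocallyIntegrable f volume) (A V : W n) :
    fderiv ℝ (mollify k f) A V = -∫ B, f B * fderiv ℝ (bumpAt k A) B V := by
  have hη : ContDiff ℝ 1 ((bump (n := n) k).normed volume) := (bump k).contDiff_normed
  have h := (bump (n := n) k).hasCompactSupport_normed (μ := volume)
  have h1 := h.hasFDerivAt_convolution_right (ContinuousLinearMap.mul ℝ ℝ) hf hη A
  rw [mollify_eq_convolution, h1.fderiv, convolution_precompR_apply _ hf (h.fderiv ℝ)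
    (hη.continuous_fderiv one_ne_zero), ← integral_neg]
  refine integral_congr_ae (ae_of_all _ fun B => ?_)
  have h2 : HasFDerivAt (bumpAt k A)
      ((fderiv ℝ ((bump (n := n) k).normed volume) (A - B)).comp
        (-(ContinuousLinearMap.id ℝ (W n)))) B :=
    (hη.differentiable (by simp) _).hasFDerivAt.comp B ((hasFDerivAt_id B).const_sub A)
  simp [h2.fderiv]

/-! ### Balance laws along smooth characteristics -/

/-- The divergence theorem for the balance law `U_y + V_t` on a strip along a characteristic
of `U`. -/
theorem abs_integral_strip_le {U V : ℝ × ℝ → ℝ} (hU : ContDiff ℝ 1 U) (hV : ContDiff ℝ 1 V)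
    {γ : ℝ → ℝ} {a b ε C : ℝ} (hab : a ≤ b)
    (hγ : ∀ s ∈ Icc a b, HasDerivAt γ (U (s, γ s)) s)
    (hdiv : ∀ s ∈ Icc a b, ∀ σ ∈ uIcc 0 ε, |fderiv ℝ U (s, γ s + σ) (1, 0) +
      fderiv ℝ V (s, γ s + σ) (0, 1)| ≤ C) :
    |(∫ s in a..b, (V (s, γ s + ε) - U (s, γ s) * U (s, γ s + ε))) -
      (∫ s in a..b, (V (s, γ s + 0) - U (s, γ s) * U (s, γ s + 0))) +
      (∫ σ in (0 : ℝ)..ε, U (b, γ b + σ)) - ∫ σ in (0 : ℝ)..ε, U (a, γ a + σ)| ≤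
      C * |ε| * (b - a) := by
  have hγc : ContinuousOn γ (Icc a b) := fun s hs => (hγ s hs).continuousAt.continuousWithinAt
  have hγ1 : ContinuousOn (fun x : ℝ × ℝ => γ x.1) (uIcc a b ×ˢ uIcc 0 ε) := by
    rw [uIcc_of_le hab]
    exact hγc.comp continuousOn_fst fun x hx => hx.1
  have hP : ContinuousOn (fun x : ℝ × ℝ => (x.1, γ x.1 + x.2)) (uIcc a b ×ˢ uIcc 0 ε) :=
    continuousOn_fst.prodMk (hγ1.add continuousOn_snd)
  have hP0 : ContinuousOn (fun x : ℝ × ℝ => (x.1, γ x.1)) (uIcc a b ×ˢ uIcc 0 ε) :=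
    continuousOn_fst.prodMk hγ1
  -- The shear `p` straightens the strip. Since `γ' = U ∘ p0`, the field `(U ∘ p, V ∘ p - (U ∘ p0)(U
  -- ∘ p))` is the pullback of `(U, V)` and has the same divergence, by `hsum`.
  let p : ℝ × ℝ → ℝ × ℝ := fun x => (x.1, γ x.1 + x.2)
  let p0 : ℝ × ℝ → ℝ × ℝ := fun x => (x.1, γ x.1)
  let F : ℝ × ℝ →L[ℝ] ℝ := ContinuousLinearMap.fst ℝ ℝ ℝ
  let S : ℝ × ℝ →L[ℝ] ℝ := ContinuousLinearMap.snd ℝ ℝ ℝ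
  let p' : ℝ × ℝ → ℝ × ℝ →L[ℝ] ℝ × ℝ := fun x => F.prod (U (p0 x) • F + S)
  let p0' : ℝ × ℝ → ℝ × ℝ →L[ℝ] ℝ × ℝ := fun x => F.prod (U (p0 x) • F)
  have hγd : ∀ x : ℝ × ℝ, x.1 ∈ Icc a b →
      HasFDerivAt (fun x : ℝ × ℝ => γ x.1) (U (p0 x) • F) x := fun x hx =>
    (hγ x.1 hx).comp_hasFDerivAt x hasFDerivAt_fst
  have hpd : ∀ x : ℝ × ℝ, x.1 ∈ Icc a b → HasFDerivAt p (p' x) x := fun x hx =>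
    hasFDerivAt_fst.prodMk ((hγd x hx).add hasFDerivAt_snd)
  have hp0d : ∀ x : ℝ × ℝ, x.1 ∈ Icc a b → HasFDerivAt p0 (p0' x) x := fun x hx =>
    hasFDerivAt_fst.prodMk (hγd x hx)
  have hUd : ∀ z, HasFDerivAt U (fderiv ℝ U z) z := fun z =>
    (hU.differentiable one_ne_zero z).hasFDerivAt
  have hVd : ∀ z, HasFDerivAt V (fderiv ℝ V z) z := fun z =>
    (hV.differentiable one_ne_zero z).hasFDerivAt
  have hmem : ∀ x ∈ Ioo (min a b) (max a b) ×ˢ Ioo (min 0 ε) (max 0 ε), x.1 ∈ Icc a b :=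
    fun x hx => by
      have := hx.1
      rw [min_eq_left hab, max_eq_right hab] at this
      exact Ioo_subset_Icc_self this
  have hsum : ∀ x, (fderiv ℝ U (p x)).comp (p' x) (1, 0) +
      ((fderiv ℝ V (p x)).comp (p' x) - (U (p0 x) • (fderiv ℝ U (p x)).comp (p' x) +
        U (p x) • (fderiv ℝ U (p0 x)).comp (p0' x))) (0, 1) =
      fderiv ℝ U (p x) (1, 0) + fderiv ℝ V (p x) (0, 1) := fun x => by
    have h1 : p' x (1, 0) = (1, 0) + U (p0 x) • (0, 1) := by simp [p', F, S]
    have h2 : p' x (0, 1) = (0, 1) := by simp [p', F, S]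
    have h3 : p0' x (0, 1) = 0 := by simp [p0', F]
    simp only [ContinuousLinearMap.comp_apply, sub_apply, add_apply, smul_apply, h1, h2, h3,
      map_add, map_smul, map_zero, smul_eq_mul]
    ring
  have hcont : ContinuousOn (fun x => fderiv ℝ U (p x) (1, 0) + fderiv ℝ V (p x) (0, 1))
      (uIcc a b ×ˢ uIcc 0 ε) :=
    (((hU.continuous_fderiv one_ne_zero).comp_continuousOn hP).clm_apply continuousOn_const).add
      (((hV.continuous_fderiv one_ne_zero).comp_continuousOn hP).clm_apply continuousOn_const)
  have key := integral2_divergence_prod_of_hasFDerivAt (fun x => U (p x))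
    (fun x => V (p x) - U (p0 x) * U (p x))
    (fun x => (fderiv ℝ U (p x)).comp (p' x))
    (fun x => (fderiv ℝ V (p x)).comp (p' x) - (U (p0 x) • (fderiv ℝ U (p x)).comp (p' x) +
      U (p x) • (fderiv ℝ U (p0 x)).comp (p0' x))) a 0 b ε
    (hU.continuous.comp_continuousOn hP)
    ((hV.continuous.comp_continuousOn hP).sub
      ((hU.continuous.comp_continuousOn hP0).mul (hU.continuous.comp_continuousOn hP)))
    (fun x hx => (hUd _).comp x (hpd x (hmem x hx)))
    (fun x hx => ((hVd _).comp x (hpd x (hmem x hx))).sub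
      (((hUd _).comp x (hp0d x (hmem x hx))).mul ((hUd _).comp x (hpd x (hmem x hx)))))
    (by
      simp only [hsum]
      exact hcont.integrableOn_compact (isCompact_uIcc.prod isCompact_uIcc))
  simp only [hsum] at key
  refine (congrArg abs key.symm).trans_le ?_
  rw [← Real.norm_eq_abs, ← abs_of_nonneg (sub_nonneg.2 hab)]
  refine intervalIntegral.norm_integral_le_of_norm_le_const fun s hs => ?_
  have hs' : s ∈ Icc a b := by
    rw [uIoc_of_le hab] at hs
    exact Ioc_subset_Icc_self hs
  rw [show |ε| = |ε - 0| by rw [sub_zero]]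
  exact intervalIntegral.norm_integral_le_of_norm_le_const fun σ hσ =>
    hdiv s hs' σ (uIoc_subset_uIcc hσ)

/-- Were `V = U² / 2`, the difference of the fluxes through the two long sides would be `(U(s, γ +
ε) - U(s, γ))² / 2 ≥ 0`; replacing `V` costs `κ` on each side. The short sides give `ε U` at the end
points up to the oscillation `o`. The sign of `ε` is free: negative `ε` yields the reverse
inequality. -/
theorem mul_sub_along_char_le {U V : ℝ × ℝ → ℝ} (hU : ContDiff ℝ 1 U) (hV : ContDiff ℝ 1 V)
    {γ : ℝ → ℝ} {a b ε C κ o : ℝ} (hab : a ≤ b)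
    (hγ : ∀ s ∈ Icc a b, HasDerivAt γ (U (s, γ s)) s)
    (hdiv : ∀ s ∈ Icc a b, ∀ σ ∈ uIcc 0 ε, |fderiv ℝ U (s, γ s + σ) (1, 0) +
      fderiv ℝ V (s, γ s + σ) (0, 1)| ≤ C)
    (hκ : ∀ s ∈ Icc a b, ∀ σ ∈ uIcc 0 ε,
      |V (s, γ s + σ) - (1 / 2) * U (s, γ s + σ) ^ 2| ≤ κ)
    (ho : ∀ s ∈ Icc a b, ∀ σ ∈ uIcc 0 ε, |U (s, γ s + σ) - U (s, γ s)| ≤ o) :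
    ε * (U (b, γ b) - U (a, γ a)) ≤ C * |ε| * (b - a) + 2 * κ * (b - a) + 2 * o * |ε| := by
  have hγc : ContinuousOn γ (uIcc a b) := by
    rw [uIcc_of_le hab]
    exact fun s hs => (hγ s hs).continuousAt.continuousWithinAt
  have hstrip := (abs_le.1 (abs_integral_strip_le hU hV hab hγ hdiv)).2
  have hc : ∀ σ : ℝ, IntervalIntegrable
      (fun s => V (s, γ s + σ) - U (s, γ s) * U (s, γ s + σ)) volume a b := fun σ =>
    ContinuousOn.intervalIntegrable (by
      have h1 : ContinuousOn (fun s => (s, γ s + σ)) (uIcc a b) :=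
        continuousOn_id.prodMk (hγc.add continuousOn_const)
      have h2 : ContinuousOn (fun s => (s, γ s)) (uIcc a b) := continuousOn_id.prodMk hγc
      exact (hV.continuous.comp_continuousOn h1).sub
        ((hU.continuous.comp_continuousOn h2).mul (hU.continuous.comp_continuousOn h1)))
  have hflux : -(2 * κ * (b - a)) ≤
      (∫ s in a..b, (V (s, γ s + ε) - U (s, γ s) * U (s, γ s + ε))) -
      (∫ s in a..b, (V (s, γ s + 0) - U (s, γ s) * U (s, γ s + 0))) := by
    rw [← intervalIntegral.integral_sub (hc _) (hc _)]
    have h1 : ∫ s in a..b, -(2 * κ) = -(2 * κ * (b - a)) := by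
      rw [intervalIntegral.integral_const, smul_eq_mul]; ring
    rw [← h1]
    refine intervalIntegral.integral_mono_on hab (by simp) ((hc _).sub (hc _)) fun s hs => ?_
    have h2 := abs_le.1 (hκ s hs ε right_mem_uIcc)
    have h3 := abs_le.1 (hκ s hs 0 left_mem_uIcc)
    rw [add_zero] at h3 ⊢
    nlinarith [sq_nonneg (U (s, γ s + ε) - U (s, γ s))]
  have hside : ∀ s ∈ Icc a b, |(∫ σ in (0 : ℝ)..ε, U (s, γ s + σ)) - ε * U (s, γ s)| ≤ o * |ε| := by
    intro s hs
    have h1 : ∫ σ in (0 : ℝ)..ε, U (s, γ s) = ε * U (s, γ s) := by simp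
    have h2 : Continuous fun σ : ℝ => U (s, γ s + σ) := hU.continuous.comp (by fun_prop)
    rw [← h1, ← intervalIntegral.integral_sub (h2.intervalIntegrable _ _) (by simp),
      show |ε| = |ε - 0| by rw [sub_zero], ← Real.norm_eq_abs]
    exact intervalIntegral.norm_integral_le_of_norm_le_const fun σ hσ =>
      ho s hs σ (uIoc_subset_uIcc hσ)
  have ha := abs_le.1 (hside a (left_mem_Icc.2 hab))
  have hb := abs_le.1 (hside b (right_mem_Icc.2 hab))
  linarith [ha.1, ha.2, hb.1, hb.2]

/-- An approximate form of Dafermos' theorem: along a characteristic, the solution of a balance law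
with bounded source is Lipschitz. -/
theorem abs_sub_along_char_le {U V : ℝ × ℝ → ℝ} (hU : ContDiff ℝ 1 U) (hV : ContDiff ℝ 1 V)
    {γ : ℝ → ℝ} {a b ε C κ o : ℝ} (hab : a ≤ b) (hε : 0 < ε)
    (hγ : ∀ s ∈ Icc a b, HasDerivAt γ (U (s, γ s)) s)
    (hdiv : ∀ s ∈ Icc a b, ∀ σ, |σ| ≤ ε → |fderiv ℝ U (s, γ s + σ) (1, 0) +
      fderiv ℝ V (s, γ s + σ) (0, 1)| ≤ C)
    (hκ : ∀ s ∈ Icc a b, ∀ σ, |σ| ≤ ε → |V (s, γ s + σ) - (1 / 2) * U (s, γ s + σ) ^ 2| ≤ κ)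
    (ho : ∀ s ∈ Icc a b, ∀ σ, |σ| ≤ ε → |U (s, γ s + σ) - U (s, γ s)| ≤ o) :
    |U (b, γ b) - U (a, γ a)| ≤ C * (b - a) + 2 * κ * (b - a) / ε + 2 * o := by
  have h1 : ∀ δ, |δ| = ε → ∀ σ ∈ uIcc 0 δ, |σ| ≤ ε := fun δ hδ σ hσ => by
    rw [← hδ]
    simpa using abs_sub_left_of_mem_uIcc hσ
  have key : ∀ δ, |δ| = ε → δ * (U (b, γ b) - U (a, γ a)) ≤
      ε * (C * (b - a) + 2 * κ * (b - a) / ε + 2 * o) := fun δ hδ => by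
    have := mul_sub_along_char_le hU hV hab hγ (ε := δ)
      (fun s hs σ hσ => hdiv s hs σ (h1 δ hδ σ hσ)) (fun s hs σ hσ => hκ s hs σ (h1 δ hδ σ hσ))
      (fun s hs σ hσ => ho s hs σ (h1 δ hδ σ hσ))
    rw [hδ] at this
    refine this.trans (le_of_eq ?_)
    field_simp
  have k1 := key ε (abs_of_pos hε)
  have k2 := key (-ε) (by rw [abs_neg, abs_of_pos hε])
  rw [abs_le]
  constructor
  · rw [neg_mul, ← mul_neg] at k2
    linarith [le_of_mul_le_mul_left k2 hε]
  · exact le_of_mul_le_mul_left k1 hε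

/-- Existence for a globally Lipschitz and bounded ordinary differential equation on the line. -/
theorem exists_hasDerivAt_of_lipschitz {f : ℝ → ℝ → ℝ} (hc : ∀ x, Continuous fun s => f s x)
    {K : ℝ≥0} (hL : ∀ s, LipschitzWith K (f s)) {M : ℝ≥0} (hM : ∀ s x, |f s x| ≤ M) {H : ℝ}
    (hH : 0 < H) : ∃ γ : ℝ → ℝ, γ 0 = 0 ∧ ∀ s ∈ Icc (-H) H, HasDerivAt γ (f s (γ s)) s := by
  -- The longer interval makes the derivatives at `±H` two-sided. The bound `M` on the speed keeps
  -- the solution in the ball of radius `M (H + 1)`.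
  let t₀ : Icc (-(H + 1)) (H + 1) := ⟨0, by constructor <;> linarith⟩
  have hpl : IsPicardLindelof f t₀ (0 : ℝ) (M * (H + 1).toNNReal) 0 M K :=
    { lipschitzOnWith := fun s _ => (hL s).lipschitzOnWith
      continuousOn := fun x _ => (hc x).continuousOn
      norm_le := fun s _ x _ => hM s x
      mul_max_le := by
        simp [t₀, Real.coe_toNNReal _ (by linarith : 0 ≤ H + 1)] }
  obtain ⟨γ, h0, hγ⟩ := hpl.exists_eq_forall_mem_Icc_hasDerivWithinAt₀
  refine ⟨γ, h0, fun s hs => (hγ s ⟨by linarith [hs.1], by linarith [hs.2]⟩).hasDerivAt ?_⟩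
  exact Icc_mem_nhds (by linarith [hs.1]) (by linarith [hs.2])

/-- Smooth approximate solutions of the balance law. -/
theorem exists_mollified_system {φ : W n → ℝ} {ω K : Set (W n)} (hω : IsOpen ω)
    (hφ : ContinuousOn φ ω) (hb : WeaklyBounded φ ω) (hK : IsCompact K) (hKω : K ⊆ ω) :
    ∃ C M : ℝ, 0 ≤ C ∧ 0 ≤ M ∧ (∀ A ∈ K, |φ A| ≤ M) ∧ ∀ η, 0 < η → ∃ u v : W n → ℝ,
      ContDiff ℝ 1 u ∧ ContDiff ℝ 1 v ∧ (∃ c, LipschitzWith c u) ∧ (∀ A, |u A| ≤ M) ∧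
      ∀ A ∈ K, |u A - φ A| ≤ η ∧ |v A - (1 / 2) * u A ^ 2| ≤ η ∧
        |fderiv ℝ u A (lineDir n 0) + fderiv ℝ v A T| ≤ C := by
  obtain ⟨K', δ, hK', hK'ω, hKK', hδ, hth⟩ := exists_compact_thickening hω hK hKω
  obtain ⟨C, hC0, hC⟩ := hb K' hK' hK'ω
  have hφK' := hφ.mono hK'ω
  have hφ2 : ContinuousOn (fun A => (1 / 2) * φ A ^ 2) K' := (hφK'.pow 2).const_mul _
  set Φ := K'.indicator φ with hΦ
  set Ψ := K'.indicator (fun A => (1 / 2) * φ A ^ 2) with hΨ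
  obtain ⟨M, hM, hΦM⟩ := exists_bound_truncation hK' hφK'
  refine ⟨C, M, hC0, hM, fun A hA => by simpa [hKK' hA] using hΦM A, fun η hη => ?_⟩
  have hM1 : 0 < M + 1 := by linarith
  -- The second term makes the error between `φ² / 2` and `u² / 2` at most `η / 2`, the mean of the
  -- two values being bounded by `M + 1`.
  set η' := min η (η / (2 * (M + 1))) with hη'
  have hη'0 : 0 < η' := lt_min hη (by positivity)
  obtain ⟨δ₁, hδ₁, hu₁⟩ := Metric.uniformContinuousOn_iff.1
    (hK'.uniformContinuousOn_of_continuous hφK') η' hη'0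
  obtain ⟨δ₂, hδ₂, hu₂⟩ := Metric.uniformContinuousOn_iff.1
    (hK'.uniformContinuousOn_of_continuous hφ2) (η / 2) (half_pos hη)
  obtain ⟨k, hk⟩ := ((tendsto_bump_rOut (n := n)).eventually
    (gt_mem_nhds (lt_min hδ (lt_min hδ₁ hδ₂)))).exists
  have hk0 := hk.trans_le (min_le_left _ _)
  have hk1 := hk.trans_le ((min_le_right _ _).trans (min_le_left _ _))
  have hk2 := hk.trans_le ((min_le_right _ _).trans (min_le_right _ _))
  have hΦi : Integrable Φ := integrable_truncation hK' hφK'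
  have hΨi : Integrable Ψ := integrable_truncation hK' hφ2
  have hu : ContDiff ℝ (⊤ : ℕ∞) (mollify k Φ) := contDiff_mollify k hΦi.locallyIntegrable
  have hv : ContDiff ℝ (⊤ : ℕ∞) (mollify k Ψ) := contDiff_mollify k hΨi.locallyIntegrable
  have huM : ∀ A, |mollify k Φ A| ≤ M := fun A => by
    have hbi : Integrable (fun B => M * bumpAt k A B) :=
      ((memLp_one_iff_integrable.1 ((isTestFunction_bumpAt (k := k) (A := A)
        (subset_univ _)).memLp 1 volume)).const_mul M)
    rw [← Real.norm_eq_abs]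
    refine (norm_integral_le_of_norm_le hbi (ae_of_all _ fun B => ?_)).trans ?_
    · rw [norm_mul, Real.norm_of_nonneg (bumpAt_nonneg k A B)]
      exact mul_le_mul_of_nonneg_right (hΦM B) (bumpAt_nonneg k A B)
    · rw [integral_const_mul, integral_bumpAt, mul_one]
  refine ⟨mollify k Φ, mollify k Ψ, hu.of_le (by simp), hv.of_le (by simp), ?_, huM,
    fun A hA => ?_⟩
  · have hs : HasCompactSupport (mollify k Φ) := by
      rw [mollify_eq_convolution]
      refine HasCompactSupport.convolution _ ?_ (bump k).hasCompactSupport_normed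
      exact HasCompactSupport.intro hK' fun A hA => indicator_of_notMem hA _
    exact hu.lipschitzWith_of_hasCompactSupport hs (by simp)
  · have hAK' := hKK' hA
    have hmem : ∀ B, dist B A < (bump (n := n) k).rOut → B ∈ K' := fun B hB =>
      hth A hA B (hB.trans hk0)
    have h1 : |mollify k Φ A - φ A| ≤ η' := by
      have := abs_mollify_sub_le (k := k) (A := A) hΦi.aestronglyMeasurable (ε := η') fun B hB => by
        rw [hΦ, indicator_of_mem (hmem B hB), indicator_of_mem hAK']
        exact (hu₁ B (hmem B hB) A hAK' (hB.trans hk1)).le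
      rwa [hΦ, indicator_of_mem hAK', ← hΦ] at this
    have h2 : |mollify k Ψ A - (1 / 2) * φ A ^ 2| ≤ η / 2 := by
      have := abs_mollify_sub_le (k := k) (A := A) hΨi.aestronglyMeasurable (ε := η / 2)
        fun B hB => by
          rw [hΨ, indicator_of_mem (hmem B hB), indicator_of_mem hAK']
          exact (hu₂ B (hmem B hB) A hAK' (hB.trans hk2)).le
      rwa [hΨ, indicator_of_mem hAK', ← hΨ] at this
    refine ⟨h1.trans (min_le_left _ _), ?_, ?_⟩
    · have h3 : |φ A| ≤ M := by simpa [hAK'] using hΦM A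
      have h4 := huM A
      have h5 : |(1 / 2) * φ A ^ 2 - (1 / 2) * mollify k Φ A ^ 2| ≤ η / 2 := by
        rw [show (1 / 2) * φ A ^ 2 - (1 / 2) * mollify k Φ A ^ 2 =
          -((mollify k Φ A - φ A) * ((φ A + mollify k Φ A) / 2)) by ring, abs_neg, abs_mul]
        have h6 : |(φ A + mollify k Φ A) / 2| ≤ M + 1 := by
          rw [abs_le] at h3 h4 ⊢
          constructor <;> linarith
        calc |mollify k Φ A - φ A| * |(φ A + mollify k Φ A) / 2|
            ≤ (η / (2 * (M + 1))) * (M + 1) := by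
              gcongr
              exact h1.trans (min_le_right _ _)
          _ = η / 2 := by field_simp
      calc _ = |(mollify k Ψ A - (1 / 2) * φ A ^ 2) +
            ((1 / 2) * φ A ^ 2 - (1 / 2) * mollify k Φ A ^ 2)| := by ring_nf
        _ ≤ η / 2 + η / 2 := (abs_add_le _ _).trans (add_le_add h2 h5)
        _ = η := add_halves η
    -- Both directions have constant coefficients on `𝕎`, so they commute with mollification; the
    -- mollified divergence at `A` is, up to sign, `weakGrad` tested on a bump of mass one.
    · have hψ : IsTestFunction (bumpAt k A) K' := isTestFunction_bumpAt fun B hB =>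
        hth A hA B (lt_of_le_of_lt hB hk0)
      have h3 := hC _ hψ (yIdx n)
      simp only [abs_of_nonneg (bumpAt_nonneg k A _), integral_bumpAt, mul_one] at h3
      rw [fderiv_mollify k hΦi.locallyIntegrable, fderiv_mollify k hΨi.locallyIntegrable,
        ← neg_add, abs_neg]
      refine le_of_eq_of_le ?_ h3
      have hi1 : ∀ {f : W n → ℝ}, ContinuousOn f K' → ∀ V : W n, Integrable fun B =>
          K'.indicator f B * fderiv ℝ (bumpAt k A) B V := fun hf V =>
        integrable_truncation_mul hK' hf (hψ.continuous_fderiv.clm_apply continuous_const)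
      rw [← integral_add (hi1 hφK' _) (hi1 hφ2 _)]
      congr 1
      refine integral_congr_ae (ae_of_all _ fun B => ?_)
      by_cases hB : B ∈ K'
      · simp [hB, X_yIdx, lineDir]
      · simp [hψ.fderiv_eq_zero hB]

/-! ### Approximate characteristics and Hölder continuity in `t` -/

/-- The point reached from `A` by moving by `s` along `∂_{x_{n+1}}` and by `t` along `∂_t`. -/
def pt (A : W n) (s t : ℝ) : W n := A + (s • lineDir n 0 + t • T)

theorem pt_zero (A : W n) : pt A 0 0 = A := by simp [pt]

theorem pt_pt (A : W n) (s t s' t' : ℝ) : pt (pt A s t) s' t' = pt A (s + s') (t + t') := by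
  simp only [pt, add_smul]
  abel

theorem dist_pt_le (A : W n) {s t r : ℝ} (hs : |s| ≤ r) (ht : |t| ≤ r) : dist (pt A s t) A ≤ r := by
  have hr : 0 ≤ r := (abs_nonneg s).trans hs
  rw [pt, dist_self_add_left]
  refine max_le ((pi_norm_le_iff_of_nonneg hr).2 fun j => ?_) (by simpa [lineDir, T] using ht)
  simp only [lineDir, T, Prod.smul_mk, Prod.fst_add, smul_zero, add_zero, Pi.smul_apply,
    Pi.single_apply, smul_eq_mul]
  split_ifs
  · simpa using hs
  · simpa using hr

/-- `γ` is, up to an error `κ`, a characteristic curve issued from `A`, along which `φ` is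
`C`-Lipschitz. -/
def ApproxChar (φ : W n → ℝ) (A : W n) (C H κ : ℝ) (γ : ℝ → ℝ) : Prop :=
  ContinuousOn γ (Icc (-H) H) ∧ γ 0 = 0 ∧ ∀ s ∈ Icc (-H) H,
    |γ s - s * φ A| ≤ (C * |s| + κ) * |s| ∧ |φ (pt A s (γ s)) - φ A| ≤ C * |s| + κ

theorem contDiff_fderiv_comp_pt {u : W n → ℝ} (hu : ContDiff ℝ 1 u) (A : W n) (p : ℝ × ℝ) :
    ContDiff ℝ 1 (fun p : ℝ × ℝ => u (pt A p.1 p.2)) ∧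
      fderiv ℝ (fun p : ℝ × ℝ => u (pt A p.1 p.2)) p (1, 0) =
        fderiv ℝ u (pt A p.1 p.2) (lineDir n 0) ∧
      fderiv ℝ (fun p : ℝ × ℝ => u (pt A p.1 p.2)) p (0, 1) = fderiv ℝ u (pt A p.1 p.2) T := by
  have h1 : HasFDerivAt (fun p : ℝ × ℝ => pt A p.1 p.2)
      ((ContinuousLinearMap.fst ℝ ℝ ℝ).smulRight (lineDir n 0) +
        (ContinuousLinearMap.snd ℝ ℝ ℝ).smulRight T) p :=
    ((hasFDerivAt_fst.smul_const _).add (hasFDerivAt_snd.smul_const _)).const_add A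
  have h2 := ((hu.differentiable one_ne_zero (pt A p.1 p.2)).hasFDerivAt).comp p h1
  have h3 : fderiv ℝ (fun p : ℝ × ℝ => u (pt A p.1 p.2)) p = _ := h2.fderiv
  refine ⟨hu.comp (contDiff_const.add ((contDiff_fst.smul contDiff_const).add
    (contDiff_snd.smul contDiff_const))), ?_, ?_⟩
  · rw [h3]; simp
  · rw [h3]; simp

/-- The curves are characteristics of mollifications of `φ`. The constants do not depend on `κ`, so
no limit curve is needed. The constant of the balance law is increased by `M / H` to secure `M ≤ C *
H`, which makes crossing curves meet within time `H`. -/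
theorem exists_approxChar {φ : W n → ℝ} {ω : Set (W n)} (hω : IsOpen ω) (hφ : ContinuousOn φ ω)
    (hb : WeaklyBounded φ ω) {A₀ : W n} (hA₀ : A₀ ∈ ω) :
    ∃ r C H M : ℝ, 0 < r ∧ 0 ≤ C ∧ 0 < H ∧ H ≤ r ∧ M * H ≤ r ∧ M ≤ C * H ∧
      closedBall A₀ (2 * r) ⊆ ω ∧ (∀ A ∈ closedBall A₀ (2 * r), |φ A| ≤ M) ∧
      ∀ A ∈ closedBall A₀ (2 * r), ∀ κ, 0 < κ → ∃ γ, ApproxChar φ A C H κ γ ∧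
        ∀ s ∈ Icc (-H) H, |γ s| ≤ M * |s| := by
  obtain ⟨ρ, hρ, hball⟩ := Metric.isOpen_iff.1 hω A₀ hA₀
  -- A strip along a curve issued from the ball of radius `2r` stays within `2r` of its origin,
  -- hence in the ball of radius `4r < ρ`.
  set r := ρ / 5 with hr
  have hr0 : 0 < r := by positivity
  have hKω : closedBall A₀ (4 * r) ⊆ ω :=
    (closedBall_subset_ball (by rw [hr]; linarith)).trans hball
  have hK : IsCompact (closedBall A₀ (4 * r)) := isCompact_closedBall _ _
  obtain ⟨C, M, hC, hM, hφM, hsys⟩ := exists_mollified_system hω hφ hb hK hKω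
  set H := r / (M + 1) with hH
  have hM1 : 0 < M + 1 := by linarith
  have hH0 : 0 < H := by positivity
  have hHr : H * (M + 1) = r := by rw [hH]; field_simp
  have hHr' : H ≤ r := by nlinarith
  have hMH : M * H ≤ r := by nlinarith
  have h24 : closedBall A₀ (2 * r) ⊆ closedBall A₀ (4 * r) :=
    closedBall_subset_closedBall (by linarith)
  refine ⟨r, C + M / H, H, M, hr0, by positivity, hH0, hHr', hMH, ?_, h24.trans hKω,
    fun A hA => hφM A (h24 hA), fun A hA κ hκ => ?_⟩
  · rw [add_mul, div_mul_cancel₀ _ hH0.ne']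
    exact le_add_of_nonneg_left (by positivity)
  obtain ⟨ε₀, hε₀, huc⟩ := Metric.uniformContinuousOn_iff.1
    (hK.uniformContinuousOn_of_continuous (hφ.mono hKω)) (κ / 8) (by positivity)
  set ε := min (ε₀ / 2) r with hε
  have hεpos : 0 < ε := lt_min (by positivity) hr0
  have hεε₀ : ε < ε₀ := (min_le_left _ _).trans_lt (half_lt_self hε₀)
  have hεr : ε ≤ r := min_le_right _ _
  -- The width `ε` is fixed first, by the modulus of continuity of `φ`, and the mollification error
  -- second, small against `κ ε / H` because the flux error is divided by `ε`. All errors in `hlip`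
  -- then add up to less than `3κ / 4`.
  set η := min (κ / 32) (κ * ε / (8 * H)) with hη
  have hηpos : 0 < η := lt_min (by positivity) (by positivity)
  have hη1 : η ≤ κ / 32 := min_le_left _ _
  have hη2 : η * H / ε ≤ κ / 8 := by
    rw [div_le_iff₀ hεpos]
    calc η * H ≤ κ * ε / (8 * H) * H := mul_le_mul_of_nonneg_right (min_le_right _ _) hH0.le
      _ = κ / 8 * ε := by field_simp
  obtain ⟨u, v, hu, hv, ⟨c, hc⟩, huM, huv⟩ := hsys η hηpos
  have hptc : ∀ A : W n, Continuous fun p : ℝ × ℝ => pt A p.1 p.2 := fun A => by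
    unfold pt; fun_prop
  obtain ⟨γ, hγ0, hγ⟩ := exists_hasDerivAt_of_lipschitz (f := fun s t => u (pt A s t)) (K := c)
    (M := ⟨M, hM⟩)
    (fun t => hu.continuous.comp ((hptc A).comp (continuous_id.prodMk continuous_const)))
    (fun s => LipschitzWith.of_dist_le_mul fun t t' => by
      refine (hc.dist_le_mul _ _).trans (mul_le_mul_of_nonneg_left ?_ c.2)
      have : pt A s t' = pt (pt A s t) 0 (t' - t) := by rw [pt_pt]; simp
      rw [this, dist_comm]
      refine dist_pt_le _ (by simp) ?_
      rw [dist_comm, Real.dist_eq]) (fun s t => huM _) hH0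
  have h0 : (0 : ℝ) ∈ Icc (-H) H := ⟨by linarith, hH0.le⟩
  have hseg : ∀ s ∈ Icc (-H) H, ∀ x ∈ uIcc 0 s, x ∈ Icc (-H) H ∧ |x| ≤ |s| := fun s hs x hx =>
    ⟨(uIcc_subset_Icc h0 hs) hx, by simpa using abs_sub_left_of_mem_uIcc hx⟩
  have hγM : ∀ s ∈ Icc (-H) H, |γ s| ≤ M * |s| := fun s hs => by
    have := (convex_uIcc 0 s).norm_image_sub_le_of_norm_hasDerivWithin_le (C := M)
      (fun x hx => (hγ x (hseg s hs x hx).1).hasDerivWithinAt)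
      (fun x hx => huM _) left_mem_uIcc right_mem_uIcc
    simpa [hγ0] using this
  have hin : ∀ s ∈ Icc (-H) H, ∀ σ, |σ| ≤ ε → pt A s (γ s + σ) ∈ closedBall A₀ (4 * r) := by
    intro s hs σ hσ
    have hs' : |s| ≤ H := abs_le.2 hs
    have h1 : |γ s + σ| ≤ 2 * r := by
      have h2 := hγM s hs
      have h3 : M * |s| ≤ M * H := mul_le_mul_of_nonneg_left hs' hM
      linarith [abs_add_le (γ s) σ]
    have h2 := dist_pt_le A (r := 2 * r) (hs'.trans (by linarith)) h1
    rw [mem_closedBall] at hA ⊢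
    linarith [dist_triangle (pt A s (γ s + σ)) A A₀]
  have hin0 : ∀ s ∈ Icc (-H) H, pt A s (γ s) ∈ closedBall A₀ (4 * r) := fun s hs => by
    simpa using hin s hs 0 (by simpa using hεpos.le)
  have hosc : ∀ s ∈ Icc (-H) H, ∀ σ, |σ| ≤ ε →
      |u (pt A s (γ s + σ)) - u (pt A s (γ s))| ≤ κ / 8 + 2 * η := by
    intro s hs σ hσ
    have h1 := (huv _ (hin s hs σ hσ)).1
    have h2 := (huv _ (hin0 s hs)).1
    have h3 : dist (pt A s (γ s + σ)) (pt A s (γ s)) < ε₀ := by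
      have : pt A s (γ s + σ) = pt (pt A s (γ s)) 0 σ := by rw [pt_pt]; simp
      rw [this]
      exact (dist_pt_le _ (by simpa using hεpos.le) hσ).trans_lt hεε₀
    have h4 := huc _ (hin s hs σ hσ) _ (hin0 s hs) h3
    rw [Real.dist_eq] at h4
    rw [abs_le] at *
    rw [abs_lt] at h4
    constructor <;> linarith
  have hchar : ∀ a b, a ∈ Icc (-H) H → b ∈ Icc (-H) H → a ≤ b → b - a ≤ H →
      |u (pt A b (γ b)) - u (pt A a (γ a))| ≤
        C * (b - a) + 2 * η * (b - a) / ε + 2 * (κ / 8 + 2 * η) := by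
    intro a b ha hb hab _
    have hsub : Icc a b ⊆ Icc (-H) H := Icc_subset_Icc ha.1 hb.2
    refine abs_sub_along_char_le (U := fun p => u (pt A p.1 p.2)) (V := fun p => v (pt A p.1 p.2))
      (contDiff_fderiv_comp_pt hu A 0).1 (contDiff_fderiv_comp_pt hv A 0).1 hab hεpos
      (fun s hs => hγ s (hsub hs)) (fun s hs σ hσ => ?_) (fun s hs σ hσ => ?_)
      (fun s hs σ hσ => hosc s (hsub hs) σ hσ)
    · rw [(contDiff_fderiv_comp_pt hu A _).2.1, (contDiff_fderiv_comp_pt hv A _).2.2]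
      exact (huv _ (hin s (hsub hs) σ hσ)).2.2
    · exact (huv _ (hin s (hsub hs) σ hσ)).2.1
  have hlip : ∀ s ∈ Icc (-H) H, |φ (pt A s (γ s)) - φ A| ≤ C * |s| + κ * (3 / 4) := by
    intro s hs
    have h1 : |u (pt A s (γ s)) - u A| ≤ C * |s| + 2 * η * |s| / ε + 2 * (κ / 8 + 2 * η) := by
      have hs' : |s| ≤ H := abs_le.2 hs
      rcases le_total 0 s with h | h
      · rw [abs_of_nonneg h] at hs' ⊢
        have := hchar 0 s h0 hs h (by linarith)
        rwa [hγ0, pt_zero, sub_zero] at this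
      · rw [abs_of_nonpos h] at hs' ⊢
        have := hchar s 0 hs h0 h (by linarith)
        rwa [hγ0, pt_zero, abs_sub_comm, zero_sub] at this
    have h2 : η * |s| / ε ≤ κ / 8 :=
      (div_le_div_of_nonneg_right (mul_le_mul_of_nonneg_left (abs_le.2 hs) hηpos.le)
        hεpos.le).trans hη2
    have h3 := (huv _ (hin0 s hs)).1
    have h4 := (huv A (h24 hA)).1
    have h5 : 2 * η * |s| / ε = 2 * (η * |s| / ε) := by ring
    rw [h5] at h1
    rw [abs_le] at h1 h3 h4 ⊢
    constructor <;> linarith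
  have hCC : C ≤ C + M / H := le_add_of_nonneg_right (by positivity)
  refine ⟨γ, ⟨fun s hs => (hγ s hs).continuousAt.continuousWithinAt, hγ0, fun s hs => ⟨?_, ?_⟩⟩, hγM⟩
  · have hd : ∀ x ∈ uIcc 0 s, HasDerivWithinAt (fun x => γ x - x * φ A)
        (u (pt A x (γ x)) - φ A) (uIcc 0 s) x := fun x hx => by
      have h1 := (hγ x (hseg s hs x hx).1).sub ((hasDerivAt_id x).mul_const (φ A))
      rw [one_mul] at h1
      exact h1.hasDerivWithinAt
    have := (convex_uIcc 0 s).norm_image_sub_le_of_norm_hasDerivWithin_le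
      (C := (C + M / H) * |s| + κ) hd (fun x hx => ?_) left_mem_uIcc right_mem_uIcc
    · simpa [hγ0] using this
    · obtain ⟨hx1, hx2⟩ := hseg s hs x hx
      have h1 := hlip x hx1
      have h2 := (huv _ (hin0 x hx1)).1
      have h3 : C * |x| ≤ (C + M / H) * |s| :=
        mul_le_mul hCC hx2 (abs_nonneg _) (by positivity)
      rw [Real.norm_eq_abs]
      rw [abs_le] at h1 h2 ⊢
      constructor <;> linarith
  · have h1 := hlip s hs
    have h2 : C * |s| ≤ (C + M / H) * |s| := mul_le_mul_of_nonneg_right hCC (abs_nonneg _)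
    linarith

/-- Two approximate characteristics issued from points of the same vertical line would cross if
the values of `φ` there were too different. -/
theorem abs_sub_vertical_le_of_pos {φ : W n → ℝ} {A : W n} {τ C H M : ℝ} (hτ : 0 < τ)
    (hC : 0 ≤ C) (hMCH : M ≤ C * H) (hA : |φ A| ≤ M) (hA' : |φ (pt A 0 τ)| ≤ M)
    (h : ∀ κ, 0 < κ → ∃ γ, ApproxChar φ A C H κ γ)
    (h' : ∀ κ, 0 < κ → ∃ γ, ApproxChar φ (pt A 0 τ) C H κ γ) :
    |φ A - φ (pt A 0 τ)| ≤ √(8 * C * τ) := by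
  by_contra! hcon
  set q := √(8 * C * τ) with hq
  set D := |φ A - φ (pt A 0 τ)| with hD
  have hq0 : 0 ≤ q := Real.sqrt_nonneg _
  have hqsq : q ^ 2 = 8 * C * τ := Real.sq_sqrt (by positivity)
  have hD0 : 0 < D := hq0.trans_lt hcon
  have hDM : D ≤ 2 * M := by linarith [abs_sub (φ A) (φ (pt A 0 τ))]
  have hCpos : 0 < C := by
    rcases hC.eq_or_lt with h0 | h0
    · rw [← h0, zero_mul] at hMCH; linarith
    · exact h0
  -- `σ` is the direction of time in which the two curves approach each other: forward if the lower
  -- point has the larger value, backward otherwise.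
  obtain ⟨σ, hσ1, hσD⟩ : ∃ σ : ℝ, |σ| = 1 ∧ σ * (φ A - φ (pt A 0 τ)) = D := by
    rcases le_total 0 (φ A - φ (pt A 0 τ)) with h0 | h0
    · exact ⟨1, abs_one, by rw [hD, abs_of_nonneg h0, one_mul]⟩
    · exact ⟨-1, by simp, by rw [hD, abs_of_nonpos h0]; ring⟩
  set κ := (D - q) / 4 with hκ
  have hκ0 : 0 < κ := by rw [hκ]; linarith
  set E := D - 2 * κ with hE
  have hEq : q < E := by rw [hE, hκ]; linarith
  have hE0 : 0 < E := hq0.trans_lt hEq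
  obtain ⟨γ, hγc, hγ0, hγ⟩ := h κ hκ0
  obtain ⟨γ', hγc', hγ0', hγ'⟩ := h' κ hκ0
  -- At time `x` the gap is at most `τ - E x + 2 C x²`. Its minimum, at `x₁`, is `τ - E² / (8C)`,
  -- negative because `E > q`. Up to `x₁` the values can approach by at most `E / 2 + 2κ < D`, so
  -- they still differ at the meeting point.
  set x₁ := E / (4 * C) with hx₁
  have hx₁0 : 0 < x₁ := by positivity
  have hx₁E : 4 * C * x₁ = E := by rw [hx₁]; field_simp
  have hx₁H : x₁ ≤ H := by
    have : 4 * C * x₁ ≤ 4 * C * H := by linarith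
    exact le_of_mul_le_mul_left this (by positivity)
  have habs : ∀ x ∈ Icc 0 x₁, |σ * x| = x := fun x hx => by
    rw [abs_mul, hσ1, one_mul, abs_of_nonneg hx.1]
  have hmaps : ∀ x ∈ Icc 0 x₁, σ * x ∈ Icc (-H) H := fun x hx =>
    abs_le.1 ((habs x hx).le.trans (hx.2.trans hx₁H))
  have hgc : ContinuousOn (fun x => τ + γ' (σ * x) - γ (σ * x)) (Icc 0 x₁) :=
    (continuousOn_const.add (hγc'.comp (by fun_prop) hmaps)).sub
      (hγc.comp (by fun_prop) hmaps)
  have hx₁m : x₁ ∈ Icc 0 x₁ := right_mem_Icc.2 hx₁0.le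
  have hneg : τ + γ' (σ * x₁) - γ (σ * x₁) ≤ 0 := by
    have k1 := (abs_le.1 (hγ _ (hmaps x₁ hx₁m)).1).1
    have k2 := (abs_le.1 (hγ' _ (hmaps x₁ hx₁m)).1).2
    rw [habs x₁ hx₁m] at k1 k2
    have k3 : σ * x₁ * φ A - σ * x₁ * φ (pt A 0 τ) = D * x₁ := by rw [← hσD]; ring
    have k4 : 8 * C * τ < E ^ 2 := by rw [← hqsq]; nlinarith
    have k5 : τ < 2 * C * x₁ ^ 2 := by
      have : 8 * C * τ < 8 * C * (2 * C * x₁ ^ 2) := by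
        rw [← hx₁E] at k4
        linarith [k4]
      exact lt_of_mul_lt_mul_left this (by positivity)
    have k6 : D * x₁ = 4 * C * x₁ * x₁ + 2 * κ * x₁ := by
      rw [hx₁E, hE]; ring
    nlinarith
  obtain ⟨x, hx, hx0⟩ := intermediate_value_Icc' hx₁0.le hgc
    (show (0 : ℝ) ∈ Icc _ _ from ⟨hneg, by simp [hγ0, hγ0', hτ.le]⟩)
  have k1 := (hγ _ (hmaps x hx)).2
  have k2 := (hγ' _ (hmaps x hx)).2
  have k3 : pt (pt A 0 τ) (σ * x) (γ' (σ * x)) = pt A (σ * x) (γ (σ * x)) := by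
    rw [pt_pt, zero_add]
    congr 1
    simp only at hx0
    linarith
  rw [k3] at k2
  rw [habs x hx] at k1 k2
  have k4 : D ≤ 2 * (C * x + κ) := by
    rw [hD]
    rw [abs_le] at k1 k2 ⊢
    constructor <;> linarith
  have k5 : C * x ≤ C * x₁ := mul_le_mul_of_nonneg_left hx.2 hC
  linarith

theorem abs_sub_vertical_le {φ : W n → ℝ} {A B : W n} {τ C H M : ℝ} (hB : B = pt A 0 τ)
    (hC : 0 ≤ C) (hMCH : M ≤ C * H) (hA : |φ A| ≤ M) (hA' : |φ B| ≤ M)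
    (h : ∀ κ, 0 < κ → ∃ γ, ApproxChar φ A C H κ γ)
    (h' : ∀ κ, 0 < κ → ∃ γ, ApproxChar φ B C H κ γ) :
    |φ A - φ B| ≤ √(8 * C * |τ|) := by
  rcases lt_trichotomy τ 0 with hτ | hτ | hτ
  · have hAB : A = pt B 0 (-τ) := by rw [hB, pt_pt]; simp [pt_zero]
    rw [abs_of_neg hτ, abs_sub_comm]
    rw [hAB] at hA h ⊢
    exact abs_sub_vertical_le_of_pos (by linarith) hC hMCH hA' hA h' h
  · rw [hB, hτ, pt_zero, sub_self, abs_zero]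
    exact Real.sqrt_nonneg _
  · rw [abs_of_pos hτ]
    subst hB
    exact abs_sub_vertical_le_of_pos hτ hC hMCH hA hA' h h'

/-- The characteristic from `A` is followed to the vertical line of `B`, where the Hölder bound
applies. Its height is known through the slope `φ A`; replacing this slope by the mean of `φ A` and
`φ B` introduces `D |h| / 2` under the root, which is absorbed into the left-hand side. -/
theorem abs_sub_planar_le {φ : W n → ℝ} {A B : W n} {h b C H : ℝ} (hC : 0 ≤ C)
    (hh : h ∈ Icc (-H) H)
    (hyp : ∀ κ, 0 < κ → ∃ γ, ApproxChar φ A C H κ γ ∧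
      |φ (pt A h (γ h)) - φ B| ≤ √(8 * C * |b - γ h|)) :
    |φ A - φ B| ≤ 12 * C * |h| + 2 * (√(8 * C) * √|b - (1 / 2) * (φ A + φ B) * h|) := by
  set D := |φ A - φ B| with hD
  set τ := |b - (1 / 2) * (φ A + φ B) * h| with hτ
  have hD0 : 0 ≤ D := abs_nonneg _
  have hh0 : 0 ≤ |h| := abs_nonneg _
  have hτ0 : 0 ≤ τ := abs_nonneg _
  have step : ∀ κ, 0 < κ → D ≤ C * |h| + κ +
      √(8 * C * (τ + (1 / 2) * D * |h| + (C * |h| + κ) * |h|)) := by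
    intro κ hκ
    obtain ⟨γ, ⟨-, -, hγ⟩, hv⟩ := hyp κ hκ
    obtain ⟨h1, h2⟩ := hγ h hh
    have h3 : |b - γ h| ≤ τ + (1 / 2) * D * |h| + (C * |h| + κ) * |h| := by
      have e : b - γ h = (b - (1 / 2) * (φ A + φ B) * h) + (-((1 / 2) * (φ A - φ B) * h)) +
          (-(γ h - h * φ A)) := by ring
      rw [e]
      refine (abs_add_three _ _ _).trans ?_
      rw [abs_neg, abs_neg, abs_mul, abs_mul, abs_of_pos (by norm_num : (0 : ℝ) < 1 / 2)]
      linarith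
    have h4 := hv.trans (Real.sqrt_le_sqrt (mul_le_mul_of_nonneg_left h3 (by positivity)))
    have h5 : D ≤ |φ (pt A h (γ h)) - φ A| + |φ (pt A h (γ h)) - φ B| := by
      rw [abs_sub_comm (φ (pt A h (γ h))) (φ A)]
      exact abs_sub_le _ _ _
    linarith
  -- The curve has disappeared from `step`, so `κ` can tend to zero.
  have hlim : D ≤ C * |h| + 0 + √(8 * C * (τ + (1 / 2) * D * |h| + (C * |h| + 0) * |h|)) := by
    have hc : Continuous fun κ : ℝ => C * |h| + κ +
        √(8 * C * (τ + (1 / 2) * D * |h| + (C * |h| + κ) * |h|)) := by fun_prop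
    exact ge_of_tendsto ((hc.tendsto 0).mono_left (nhdsWithin_le_nhds (s := Ioi 0)))
      (eventually_nhdsWithin_of_forall fun κ hκ => step κ hκ)
  have hsq : √(8 * C * (τ + (1 / 2) * D * |h| + (C * |h| + 0) * |h|)) ≤
      √(8 * C) * √τ + (D / 2 + 5 * C * |h|) := by
    refine Real.sqrt_le_iff.2 ⟨by positivity, ?_⟩
    have h1 : √(8 * C) ^ 2 = 8 * C := Real.sq_sqrt (by positivity)
    have h2 : √τ ^ 2 = τ := Real.sq_sqrt hτ0
    have h3 : 0 ≤ √(8 * C) * √τ * (D / 2 + 5 * C * |h|) := by positivity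
    have h4 : (√(8 * C) * √τ) ^ 2 = 8 * C * τ := by rw [mul_pow, h1, h2]
    have h5 : 0 ≤ C * D * |h| := by positivity
    nlinarith [sq_nonneg D, sq_nonneg (C * |h|)]
  linarith

/-! ### From neighbourhoods of points to relatively compact sets -/

theorem graphDist_nonneg (φ : W n → ℝ) (A B : W n) : 0 ≤ graphDist φ A B := by
  rw [graphDist_eq]
  positivity

theorem graphDist_pos {φ : W n → ℝ} {A B : W n} (h : A ≠ B) : 0 < graphDist φ A B := by
  refine (graphDist_nonneg φ A B).lt_of_ne fun h0 => h ?_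
  have h1 : B.1 - A.1 = 0 :=
    norm_eq_zero.1 (le_antisymm ((norm_fst_le_graphDist φ A B).trans h0.ge) (norm_nonneg _))
  have h2 : ∀ i, B.1 i - A.1 i = 0 := fun i => congrFun h1 i
  have h3 : field (0 : WIdx n → ℝ) A = 0 := by simp [field]
  rw [graphDist_eq_field, h1, h3] at h0
  simp only [h2, ne_eq, OfNat.ofNat_ne_zero, not_false_eq_true, zero_pow, Finset.sum_const_zero,
    Real.sqrt_zero, Prod.snd_zero, sub_zero, mul_zero, zero_add] at h0
  have h4 := (Real.sqrt_eq_zero (abs_nonneg _)).1 h0.symm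
  exact Prod.ext (sub_eq_zero.1 h1).symm (sub_eq_zero.1 (abs_eq_zero.1 h4)).symm

theorem continuousOn_graphDist {φ : W n → ℝ} {K : Set (W n)} (hφ : ContinuousOn φ K) :
    ContinuousOn (fun p : W n × W n => graphDist φ p.1 p.2) (K ×ˢ K) := by
  simp only [graphDist_eq]
  have h1 : ContinuousOn (fun p : W n × W n => φ p.1) (K ×ˢ K) :=
    hφ.comp continuousOn_fst fun p hp => hp.1
  have h2 : ContinuousOn (fun p : W n × W n => φ p.2) (K ×ˢ K) :=
    hφ.comp continuousOn_snd fun p hp => hp.2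
  have h3 : ∀ i, Continuous fun p : W n × W n => (toHeis p.1).x i := fun i =>
    (continuous_toHeis_x i).comp continuous_fst
  have h4 : ∀ i, Continuous fun p : W n × W n => (toHeis p.2).x i := fun i =>
    (continuous_toHeis_x i).comp continuous_snd
  have h5 : Continuous fun p : W n × W n => ∑ j : Fin n,
      ((toHeis p.1).x (Sum.inr j) * (toHeis p.2).x (Sum.inl j) -
        (toHeis p.1).x (Sum.inl j) * (toHeis p.2).x (Sum.inr j)) :=
    continuous_finsetSum _ fun j _ => ((h3 _).mul (h4 _)).sub ((h3 _).mul (h4 _))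
  have h6 : Continuous fun p : W n × W n => √(∑ i, (p.2.1 i - p.1.1 i) ^ 2) := by fun_prop
  have h7 : Continuous fun p : W n × W n => p.2.2 - p.1.2 := by fun_prop
  have h8 : Continuous fun p : W n × W n => p.2.1 (yIdx n) - p.1.1 (yIdx n) := by fun_prop
  exact h6.continuousOn.add ((((h7.continuousOn.sub ((continuousOn_const.mul (h1.add h2)).mul
    h8.continuousOn)).add (h5.continuousOn.const_mul _)).abs).sqrt)

/-- It is enough to know that `φ` is intrinsic Lipschitz near every point. -/
theorem locallyIntrinsicLipschitzOn_of_nhds {φ : W n → ℝ} {ω : Set (W n)}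
    (hφ : ContinuousOn φ ω) (h : ∀ A ∈ ω, ∃ U ∈ 𝓝 A, IntrinsicLipschitzOn φ U) :
    LocallyIntrinsicLipschitzOn φ ω := by
  intro ω' hK hKω
  set K := closure ω' with hKdef
  have hφK := hφ.mono hKω
  suffices H : ∃ L : ℝ, 0 < L ∧ ∀ p ∈ K ×ˢ K, |φ p.1 - φ p.2| ≤ L * graphDist φ p.1 p.2 by
    obtain ⟨L, hL, hLip⟩ := H
    exact ⟨L, hL, fun A hA B hB => hLip (A, B) ⟨subset_closure hA, subset_closure hB⟩⟩
  -- Compactness is used on pairs. Near the diagonal the local hypothesis applies; near a pair of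
  -- distinct points the quasidistance is bounded below and `φ` is bounded.
  refine (hK.prod hK).induction_on (p := fun S => ∃ L : ℝ, 0 < L ∧ ∀ p ∈ S,
    |φ p.1 - φ p.2| ≤ L * graphDist φ p.1 p.2) ⟨1, one_pos, fun p hp => hp.elim⟩
    (fun S S' hS ⟨L, hL, hLip⟩ => ⟨L, hL, fun p hp => hLip p (hS hp)⟩)
    (fun S S' ⟨L, hL, hLip⟩ ⟨L', _, hLip'⟩ => ⟨max L L', lt_max_of_lt_left hL, ?_⟩) ?_
  · rintro p (hp | hp)
    · exact (hLip p hp).trans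
        (mul_le_mul_of_nonneg_right (le_max_left _ _) (graphDist_nonneg _ _ _))
    · exact (hLip' p hp).trans
        (mul_le_mul_of_nonneg_right (le_max_right _ _) (graphDist_nonneg _ _ _))
  · rintro ⟨A, B⟩ ⟨hA, hB⟩
    by_cases hAB : A = B
    · subst hAB
      obtain ⟨U, hU, L, hL, hLip⟩ := h A (hKω hA)
      exact ⟨U ×ˢ U, mem_nhdsWithin_of_mem_nhds (prod_mem_nhds hU hU), L, hL,
        fun p hp => hLip _ hp.1 _ hp.2⟩
    · have hd := graphDist_pos (φ := φ) hAB
      obtain ⟨M, hM⟩ := hK.exists_bound_of_continuousOn hφK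
      have hM0 : 0 ≤ M := (norm_nonneg _).trans (hM A hA)
      refine ⟨{p | graphDist φ A B / 2 < graphDist φ p.1 p.2} ∩ K ×ˢ K, inter_mem
        (((continuousOn_graphDist hφK) (A, B) ⟨hA, hB⟩).eventually (lt_mem_nhds (half_lt_self hd)))
        self_mem_nhdsWithin, (2 * M + 1) / (graphDist φ A B / 2), by positivity, ?_⟩
      rintro p ⟨hp, hpK⟩
      have h1 : |φ p.1 - φ p.2| ≤ 2 * M + 1 := by
        have := abs_sub (φ p.1) (φ p.2)
        have h2 := hM _ hpK.1
        have h3 := hM _ hpK.2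
        rw [Real.norm_eq_abs] at h2 h3
        linarith
      refine h1.trans ?_
      rw [div_mul_eq_mul_div, le_div_iff₀ (by positivity)]
      exact mul_le_mul_of_nonneg_left (le_of_lt hp) (by positivity)

/-! ### Joining two nearby points -/

/-- The displacement from `A` to `B` in the coordinates other than `x_{n+1}` and `t`. -/
def sideStep (A B : W n) : WIdx n → ℝ := Function.update (B.1 - A.1) (yIdx n) 0

theorem sideStep_yIdx (A B : W n) : sideStep A B (yIdx n) = 0 := by simp [sideStep]

theorem sub_fst_eq (A B : W n) :
    B.1 - A.1 = sideStep A B + (B.1 (yIdx n) - A.1 (yIdx n)) • Pi.single (yIdx n) 1 := by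
  ext i
  by_cases hi : i = yIdx n
  · subst hi; simp [sideStep]
  · simp [sideStep, hi]

/-- On `𝕎` the field `X_{n+1}` has no `∂_t` part, so the `x_{n+1}` displacement does not contribute.
-/
theorem field_sub_snd (A B : W n) : (field (B.1 - A.1) A).2 = (field (sideStep A B) A).2 := by
  have h : field (B.1 - A.1) A = field (sideStep A B) A +
      (B.1 (yIdx n) - A.1 (yIdx n)) • X (yIdx n) A := by
    rw [← field_single, ← field_smul]
    simp only [field, ← Finset.sum_add_distrib, ← add_smul]
    refine Finset.sum_congr rfl fun i _ => ?_
    congr 1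
    exact congrFun (sub_fst_eq A B) i
  rw [h, X_yIdx]
  simp

theorem pt_flow_sideStep (A B : W n) :
    B = pt (flow (sideStep A B) 1 A) (B.1 (yIdx n) - A.1 (yIdx n))
      (B.2 - A.2 - (field (B.1 - A.1) A).2) := by
  rw [field_sub_snd]
  refine Prod.ext ?_ ?_
  · have := sub_fst_eq A B
    rw [sub_eq_iff_eq_add] at this
    simp only [pt, flow_apply, one_smul, Prod.fst_add, field_fst, Prod.smul_fst, lineDir, T,
      smul_zero, add_zero]
    refine this.trans ?_
    abel
  · simp [pt, flow_apply, lineDir, T]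

theorem continuous_flow_sideStep :
    Continuous fun p : (W n × W n) × ℝ => flow (sideStep p.1.1 p.1.2) p.2 p.1.1 := by
  simp only [flow_apply, field]
  have h1 : ∀ i, Continuous fun p : (W n × W n) × ℝ => sideStep p.1.1 p.1.2 i := fun i => by
    by_cases hi : i = yIdx n
    · subst hi; simpa only [sideStep_yIdx] using continuous_const
    · simp only [sideStep, ne_eq, hi, not_false_eq_true, Function.update_of_ne, Pi.sub_apply]
      fun_prop
  exact (continuous_fst.comp continuous_fst).add (continuous_snd.smul
    (continuous_finsetSum _ fun i _ => (h1 i).smul ((continuous_X i).comp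
      (continuous_fst.comp continuous_fst))))

theorem sum_abs_sideStep_le (φ : W n → ℝ) (A B : W n) :
    ∑ i, |sideStep A B i| ≤ Fintype.card (WIdx n) * graphDist φ A B := by
  have h1 : ∀ i ∈ (Finset.univ : Finset (WIdx n)), |sideStep A B i| ≤ graphDist φ A B := by
    intro i _
    by_cases hi : i = yIdx n
    · subst hi
      rw [sideStep_yIdx, abs_zero]
      exact graphDist_nonneg _ _ _
    · simp only [sideStep, ne_eq, hi, not_false_eq_true, Function.update_of_ne]
      exact (norm_le_pi_norm (B.1 - A.1) i).trans (norm_fst_le_graphDist φ A B)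
  simpa using Finset.sum_le_card_nsmul _ _ _ h1

/-- The flow of the linear fields leads from `A` to a point `A'` in the `(x_{n+1}, t)` plane of `B`,
changing `φ` by at most `c d`; the planar estimate compares `A'` with `B`. -/
theorem WeaklyBounded.exists_nhds_intrinsicLipschitzOn {φ : W n → ℝ} {ω : Set (W n)}
    (hω : IsOpen ω) (hφ : ContinuousOn φ ω) (hb : WeaklyBounded φ ω) {A₀ : W n} (hA₀ : A₀ ∈ ω) :
    ∃ U ∈ 𝓝 A₀, IntrinsicLipschitzOn φ U := by
  obtain ⟨r, C, H, M, hr, hC, hH, hHr, hMHr, hMCH, hball, hφM, hchar⟩ :=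
    exists_approxChar hω hφ hb hA₀
  have hrω : closedBall A₀ r ⊆ ω := (closedBall_subset_closedBall (by linarith)).trans hball
  obtain ⟨C₁, hC₁, hlin⟩ := hb _ (isCompact_closedBall A₀ r) hrω
  have htube : ∀ᶠ p : W n × W n in 𝓝 (A₀, A₀), ∀ s ∈ Icc (0 : ℝ) 1,
      flow (sideStep p.1 p.2) s p.1 ∈ ball A₀ r :=
    isCompact_Icc.eventually_forall_of_forall_eventually fun s _ =>
      continuous_flow_sideStep.continuousAt.eventually_mem (isOpen_ball.mem_nhds (by
        have h0 : sideStep A₀ A₀ = 0 := by simp [sideStep]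
        simp [h0, flow_apply, field, hr]))
  have hy : ∀ᶠ p : W n × W n in 𝓝 (A₀, A₀), |p.2.1 (yIdx n) - p.1.1 (yIdx n)| < H := by
    have hc : Continuous fun p : W n × W n => |p.2.1 (yIdx n) - p.1.1 (yIdx n)| := by fun_prop
    exact hc.continuousAt.eventually_lt continuousAt_const (by simpa using hH)
  have hB : ∀ᶠ p : W n × W n in 𝓝 (A₀, A₀), p.2 ∈ ball A₀ r :=
    continuous_snd.continuousAt.eventually_mem (ball_mem_nhds A₀ hr)
  obtain ⟨U, hU, hUU⟩ := mem_prod_same_iff.1 (nhds_prod_eq (x := A₀) (y := A₀) ▸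
    (htube.and (hy.and hB)))
  set c := Fintype.card (WIdx n) * C₁ with hc
  have hc0 : 0 ≤ c := by positivity
  refine ⟨U, hU, c + 12 * C + 2 * (√(8 * C) * (1 + (c + 1))) + 1, by positivity,
    fun A hA B hB => ?_⟩
  obtain ⟨hseg, hyAB, hBr⟩ := hUU (mk_mem_prod hA hB)
  simp only at hseg hyAB hBr
  set d := graphDist φ A B with hd
  have hd0 : 0 ≤ d := graphDist_nonneg _ _ _
  set A' := flow (sideStep A B) 1 A with hA'
  have hA'r : A' ∈ ball A₀ r := hseg 1 (by simp)
  have h1 : |φ A' - φ A| ≤ c * d := by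
    refine (abs_sub_flow_le hω hφ (isCompact_closedBall A₀ r) hrω hlin (sideStep_yIdx A B)
      fun s hs => ball_subset_interior_closedBall (hseg s hs)).trans ?_
    rw [hc, mul_right_comm]
    exact mul_le_mul_of_nonneg_right (sum_abs_sideStep_le φ A B) hC₁
  set h := B.1 (yIdx n) - A.1 (yIdx n) with hh
  set b := B.2 - A.2 - (field (B.1 - A.1) A).2 with hbdef
  have hBpt : B = pt A' h b := pt_flow_sideStep A B
  have hhH : h ∈ Icc (-H) H := abs_le.1 hyAB.le
  have hhd : |h| ≤ d := (norm_le_pi_norm (B.1 - A.1) (yIdx n)).trans (norm_fst_le_graphDist φ A B)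
  have hin : ∀ D ∈ ball A₀ r, D ∈ closedBall A₀ (2 * r) := fun D hD =>
    mem_closedBall.2 ((mem_ball.1 hD).le.trans (by linarith))
  have h2 : |φ A' - φ B| ≤ 12 * C * |h| +
      2 * (√(8 * C) * √|b - (1 / 2) * (φ A' + φ B) * h|) := by
    refine abs_sub_planar_le hC hhH fun κ hκ => ?_
    obtain ⟨γ, hγ, hγM⟩ := hchar A' (hin A' hA'r) κ hκ
    refine ⟨γ, hγ, ?_⟩
    have hD : pt A' h (γ h) ∈ closedBall A₀ (2 * r) := by
      have h3 : dist (pt A' h (γ h)) A' ≤ r := by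
        refine dist_pt_le A' (hyAB.le.trans hHr) ((hγM h hhH).trans ?_)
        have hM0 : 0 ≤ M := (abs_nonneg _).trans (hφM B (hin B hBr))
        exact (mul_le_mul_of_nonneg_left hyAB.le hM0).trans hMHr
      rw [mem_ball] at hA'r
      rw [mem_closedBall]
      linarith [dist_triangle (pt A' h (γ h)) A' A₀]
    refine abs_sub_vertical_le (H := H) (M := M) ?_ hC hMCH (hφM _ hD) (hφM _ (hin B hBr))
      (fun κ hκ => ?_) (fun κ hκ => ?_)
    · rw [pt_pt]
      conv_lhs => rw [hBpt]
      congr 1 <;> ring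
    · obtain ⟨γ, hγ, -⟩ := hchar _ hD κ hκ
      exact ⟨γ, hγ⟩
    · obtain ⟨γ, hγ, -⟩ := hchar _ (hin B hBr) κ hκ
      exact ⟨γ, hγ⟩
  have h3 : √|b - (1 / 2) * (φ A + φ B) * h| ≤ d := by
    rw [hd, graphDist_eq_field]
    exact le_add_of_nonneg_left (Real.sqrt_nonneg _)
  -- The planar estimate involves `φ A'` where the quasidistance has `φ A`. The exchange costs at
  -- most `c d² / 2` under the root, which is of the order of `d²` already present.
  have h4 : √|b - (1 / 2) * (φ A' + φ B) * h| ≤ (1 + (c + 1)) * d := by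
    have h5 : |b - (1 / 2) * (φ A + φ B) * h| ≤ d ^ 2 := by
      rw [← Real.sqrt_le_left hd0]; exact h3
    refine Real.sqrt_le_iff.2 ⟨by positivity, ?_⟩
    have e : b - (1 / 2) * (φ A' + φ B) * h = (b - (1 / 2) * (φ A + φ B) * h) +
        (-((1 / 2) * ((φ A' - φ A) * h))) := by ring
    have h6 : |(φ A' - φ A) * h| ≤ c * d * d := by
      rw [abs_mul]
      exact mul_le_mul h1 hhd (abs_nonneg _) (by positivity)
    rw [e]
    refine (abs_add_le _ _).trans ?_
    rw [abs_neg, abs_mul, abs_of_pos (by norm_num : (0 : ℝ) < 1 / 2)]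
    have h7 : 0 ≤ c * d ^ 2 := by positivity
    have h8 : 0 ≤ c ^ 2 * d ^ 2 := by positivity
    nlinarith
  have h9 : |φ A - φ B| ≤ |φ A' - φ A| + |φ A' - φ B| := by
    rw [abs_sub_comm (φ A') (φ A)]
    exact abs_sub_le _ _ _
  have h10 : 12 * C * |h| ≤ 12 * C * d := mul_le_mul_of_nonneg_left hhd (by positivity)
  have h11 := mul_le_mul_of_nonneg_left h4 (Real.sqrt_nonneg (8 * C))
  linarith

end HeisenbergGraph

end

theorem theorem1p1 (n : ℕ) [NeZero n] (ω : Set (HeisenbergGraph.W n)) (hω : IsOpen ω)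
    (φ : HeisenbergGraph.W n → ℝ) (hφ : ContinuousOn φ ω) :
    HeisenbergGraph.LocallyIntrinsicLipschitzOn φ ω ↔
      ∃ w : HeisenbergGraph.W n → (HeisenbergGraph.WIdx n → ℝ),
        HeisenbergGraph.LocallyEssBounded w ω ∧
          HeisenbergGraph.IsDistributionalSolution φ w ω := by
  rw [← HeisenbergGraph.weaklyBounded_iff hω hφ]
  exact ⟨fun h => h.weaklyBounded hω hφ, fun h =>
    HeisenbergGraph.locallyIntrinsicLipschitzOn_of_nhds hφ fun _ hA =>
      h.exists_nhds_intrinsicLipschitzOn hω hφ hA⟩
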